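/- **Definitions.** A *skew algebra* is a skew Boolean algebra with intersections: a set $A$ with operations $0,\wedge,\vee,\setminus,\cap$ such that $\wedge,\vee$ are idempotent and associative and satisfy the absorption laws $x\wedge(x\vee y)=x=(y\vee x)\wedge x$ and $x\vee(x\wedge y)=x=(y\wedge x)\vee x$; $\wedge$ distributes over $\vee$ on both sides; $0$ is neutral for $\vee$; $(x\setminus y)\wedge(x\wedge y\wedge x)=0$ and $(x\setminus y)\vee(x\wedge y\wedge x)=x$; and $x\cap y$ is the greatest lower bound of $x,y$ for the natural partial order $x\le y\iff x\wedge y=y\wedge x=x$. It is *right-handed* if $x\wedge y\wedge x=y\wedge x$. Homomorphisms preserve all five operations. A *$\le$-ideal* is a subset that is closed under finite joins (so it contains $0$) and downward closed for $\le$. A homomorphism $f:A\to A'$ is *$\le$-cofinal* if the smallest $\le$-ideal of $A'$ containing the image of $f$ is $A'$. A *Boolean space* is a locally compact Hausdorff space with a base of clopen sets. A *skew Boolean space* is a surjective local homeomorphism $p:E\to B$ between Boolean spaces. A *morphism* $(g,h)$ from $p:E\to B$ to $p':E'\to B'$ consists of continuous partial maps $g:E\rightharpoonup E'$ and $h:B\rightharpoonup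 B'$ with open domains that are proper (inverse images of compact sets are compact), such that $p(\operatorname{dom} g)\subseteq\operatorname{dom} h$, $p'\circ g=h\circ p$ on $\operatorname{dom} g$, and for every $x\in\operatorname{dom} h$ the map $g$ restricts to a bijection from $p^{-1}(x)\cap\operatorname{dom} g$ onto $p'^{-1}(h(x))$. It is *total* if $g$ and $h$ are both defined everywhere. For a skew Boolean space $p:E\to B$ let $A_p$ be the set of compact open $S\subseteq E$ on which $p$ is injective, with $\sigma(S)=p^{-1}(p(S))$ and $0=\emptyset$, $S\wedge R=\sigma(S)\cap R$, $S\vee R=S\cup(R\setminus\sigma(S))$, $S\setminus R=S\setminus\sigma(R)$ (set difference on the right), and $S\cap R$ the set intersection. It is a right-handed skew algebra, and a morphism $(g,h):p\to p'$ induces the homomorphism $A_{p'}\to A_p$, $S\mapsto g^{-1}(S)$. An *ideal* of a skew algebra $A$ is a subset closed under finite joins and downward closed for the preorder $x\preceq y\iff x\wedge y\wedge x=x$; it is *prime* if it is proper and $a\wedge b\in P$ implies $a\in P$ or $b\in P$. For a prime ideal $P$ let $\theta_P$ be the least congruence on $A$ whose zero-class contains $P$. Let $\mathrm{St}(A)$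 be the set of prime ideals, with the topology generated by the sets $N_a=\{P : a\notin P\}$, $a\in A$. Let $\mathrm{Sk}(A)$ be the set of pairs $P_t=(P,[t]_{\theta_P})$ with $P$ prime and $t\notin P$, with the topology generated by the sets $M_a=\{P_a : a\notin P\}$, $a\in A$. Let $q_A:\mathrm{Sk}(A)\to\mathrm{St}(A)$, $P_t\mapsto P$. For a homomorphism $f:A\to A'$ let $f_\downarrow:\mathrm{St}(A')\rightharpoonup\mathrm{St}(A)$ be $P\mapsto f^{-1}(P)$, defined when $f^{-1}(P)\ne A$, and let $f^\uparrow:\mathrm{Sk}(A')\rightharpoonup\mathrm{Sk}(A)$ be $P_{f(a)}\mapsto (f^{-1}(P))_a$, defined at the points $P_{f(a)}$ with $f(a)\notin P$. **Theorem.** 1. A morphism of skew Boolean spaces is total if and only if it is a pullback square, i.e. $g$ and $h$ are everywhere defined and the square of continuous maps $E\to E'$, $E\to B$, $E'\to B'$, $B\to B'$ is a pullback of topological spaces. 2. The assignment $A\mapsto q_A$, $f\mapsto(f^\uparrow,f_\downarrow)$ is a well-defined contravariant functor from right-handed skew algebras to skew Boolean spaces. Together with the contravariant functor $p\mapsto A_p$,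 $(g,h)\mapsto g^{-1}$ it forms a duality (a contravariant equivalence) between the category of skew Boolean spaces and the category of right-handed skew algebras. 3. Under this duality total morphisms correspond exactly to $\le$-cofinal homomorphisms: a morphism $(g,h)$ is total if and only if the homomorphism $S\mapsto g^{-1}(S)$ is $\le$-cofinal, and a homomorphism $f$ of right-handed skew algebras is $\le$-cofinal if and only if $(f^\uparrow,f_\downarrow)$ is total. 4. Consequently the two functors restrict to a duality between the category of skew Boolean spaces and total morphisms and the category of right-handed skew algebras and $\le$-cofinal homomorphisms. -/

import Mathlib

open CategoryTheory Opposite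

universe u

/-! ### Skew Boolean algebras with intersections -/

/-- A skew lattice: idempotent associative meet `⊓` and join `⊔` with the absorption identities. -/
class SkewLattice (A : Type u) extends Min A, Max A where
  inf_idem : ∀ x : A, x ⊓ x = x
  sup_idem : ∀ x : A, x ⊔ x = x
  inf_assoc : ∀ x y z : A, (x ⊓ y) ⊓ z = x ⊓ (y ⊓ z)
  sup_assoc : ∀ x y z : A, (x ⊔ y) ⊔ z = x ⊔ (y ⊔ z)
  inf_sup_absorb : ∀ x y : A, x ⊓ (x ⊔ y) = x
  sup_inf_absorb' : ∀ x y : A, (y ⊔ x) ⊓ x = x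
  sup_inf_absorb : ∀ x y : A, x ⊔ (x ⊓ y) = x
  inf_sup_absorb' : ∀ x y : A, (y ⊓ x) ⊔ x = x

/-- The natural partial order of a skew lattice. -/
def NatLE {A : Type u} [SkewLattice A] (x y : A) : Prop := x ⊓ y = x ∧ y ⊓ x = x

/-- The natural preorder of a skew lattice. -/
def NatPreLE {A : Type u} [SkewLattice A] (x y : A) : Prop := x ⊓ y ⊓ x = x

/-- A skew Boolean algebra. -/
class SkewBooleanAlgebra (A : Type u) extends SkewLattice A, Zero A, SDiff A where
  inf_sup_left : ∀ x y z : A, x ⊓ (y ⊔ z) = (x ⊓ y) ⊔ (x ⊓ z)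
  inf_sup_right : ∀ x y z : A, (y ⊔ z) ⊓ x = (y ⊓ x) ⊔ (z ⊓ x)
  zero_sup : ∀ x : A, 0 ⊔ x = x
  sup_zero : ∀ x : A, x ⊔ 0 = x
  sdiff_inf : ∀ x y : A, (x \ y) ⊓ (x ⊓ y ⊓ x) = 0
  sdiff_sup : ∀ x y : A, (x \ y) ⊔ (x ⊓ y ⊓ x) = x

/-- A skew algebra, that is, a skew Boolean algebra with intersections: any two elements have
a greatest lower bound `x ∩ y` for the natural partial order. -/
class SkewAlgebra (A : Type u) extends SkewBooleanAlgebra A, Inter A where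
  inter_le_left : ∀ x y : A, NatLE (x ∩ y) x
  inter_le_right : ∀ x y : A, NatLE (x ∩ y) y
  le_inter : ∀ x y z : A, NatLE z x → NatLE z y → NatLE z (x ∩ y)

/-- A homomorphism of skew algebras preserves all the operations. -/
@[ext]
structure SkewHom (A B : Type u) [SkewAlgebra A] [SkewAlgebra B] where
  toFun : A → B
  map_zero : toFun 0 = 0
  map_inf : ∀ x y, toFun (x ⊓ y) = toFun x ⊓ toFun y
  map_sup : ∀ x y, toFun (x ⊔ y) = toFun x ⊔ toFun y
  map_sdiff : ∀ x y, toFun (x \ y) = toFun x \ toFun y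
  map_inter : ∀ x y, toFun (x ∩ y) = toFun x ∩ toFun y

namespace SkewHom

/-- The identity homomorphism. -/
def id (A : Type u) [SkewAlgebra A] : SkewHom A A where
  toFun := fun x => x
  map_zero := rfl
  map_inf _ _ := rfl
  map_sup _ _ := rfl
  map_sdiff _ _ := rfl
  map_inter _ _ := rfl

/-- The composite `g ∘ f`. -/
def comp {A B C : Type u} [SkewAlgebra A] [SkewAlgebra B] [SkewAlgebra C]
    (g : SkewHom B C) (f : SkewHom A B) : SkewHom A C where
  toFun := fun x => g.toFun (f.toFun x)
  map_zero := by simp [f.map_zero, g.map_zero]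
  map_inf x y := by simp [f.map_inf, g.map_inf]
  map_sup x y := by simp [f.map_sup, g.map_sup]
  map_sdiff x y := by simp [f.map_sdiff, g.map_sdiff]
  map_inter x y := by simp [f.map_inter, g.map_inter]

theorem map_natLE {A B : Type u} [SkewAlgebra A] [SkewAlgebra B] (f : SkewHom A B) {x y : A}
    (h : NatLE x y) : NatLE (f.toFun x) (f.toFun y) :=
  ⟨by rw [← f.map_inf, h.1], by rw [← f.map_inf, h.2]⟩

end SkewHom

/-- A `≤`-ideal: a subset closed under finite joins (the empty join `0` included) and downward
closed for the natural partial order. -/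
structure IsLeqIdeal {A : Type u} [SkewAlgebra A] (I : Set A) : Prop where
  zero_mem : (0 : A) ∈ I
  sup_mem : ∀ x ∈ I, ∀ y ∈ I, x ⊔ y ∈ I
  lower : ∀ x y : A, NatLE x y → y ∈ I → x ∈ I

/-- The `≤`-ideal generated by a subset. -/
def leqIdeal {A : Type u} [SkewAlgebra A] (S : Set A) : Set A :=
  {x | ∀ I : Set A, IsLeqIdeal I → S ⊆ I → x ∈ I}

/-- A homomorphism is `≤`-cofinal when the `≤`-ideal generated by its image is everything. -/
def SkewHom.IsLeqCofinal {A B : Type u} [SkewAlgebra A] [SkewAlgebra B] (f : SkewHom A B) : Prop :=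
  leqIdeal (Set.range f.toFun) = Set.univ

/-- Right-handed skew algebras. -/
structure RSkewAlg : Type (u + 1) where
  carrier : Type u
  [str : SkewAlgebra carrier]
  rightHanded : ∀ x y : carrier, x ⊓ y ⊓ x = y ⊓ x

attribute [instance] RSkewAlg.str

/-- The category of right-handed skew algebras and all homomorphisms. -/
instance : Category.{u} RSkewAlg.{u} where
  Hom A B := SkewHom A.carrier B.carrier
  id A := SkewHom.id A.carrier
  comp f g := SkewHom.comp g f

/-- The `≤`-cofinal homomorphisms, as a class of morphisms. -/
def leqCofinal : MorphismProperty RSkewAlg.{u} := fun A B f =>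
  SkewHom.IsLeqCofinal (A := A.carrier) (B := B.carrier) f

theorem leqCofinal_id (A : RSkewAlg.{u}) : leqCofinal (𝟙 A) := by
  refine Set.eq_univ_of_forall fun x I _ hS => hS ⟨x, rfl⟩

theorem leqCofinal_comp {A B C : RSkewAlg.{u}} (f : A ⟶ B) (g : B ⟶ C) (hf : leqCofinal f)
    (hg : leqCofinal g) : leqCofinal (f ≫ g) := by
  refine Set.eq_univ_of_forall fun z I hI hS => ?_
  have key : ∀ y : B.carrier, SkewHom.toFun g y ∈ I := by
    intro y
    have hy : y ∈ leqIdeal (Set.range (SkewHom.toFun f)) := hf ▸ Set.mem_univ y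
    refine hy {y | SkewHom.toFun g y ∈ I} ⟨?_, ?_, ?_⟩ ?_
    · change SkewHom.toFun g 0 ∈ I
      rw [SkewHom.map_zero g]
      exact hI.zero_mem
    · intro a ha b hb
      change SkewHom.toFun g (a ⊔ b) ∈ I
      rw [SkewHom.map_sup g]
      exact hI.sup_mem _ ha _ hb
    · intro a b hab hb
      exact hI.lower _ _ (SkewHom.map_natLE g hab) hb
    · rintro _ ⟨x, rfl⟩
      exact hS ⟨x, rfl⟩
  have hz : z ∈ leqIdeal (Set.range (SkewHom.toFun g)) := hg ▸ Set.mem_univ z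
  refine hz I hI ?_
  rintro _ ⟨y, rfl⟩
  exact key y

instance : (leqCofinal.{u}).IsMultiplicative where
  id_mem := leqCofinal_id
  comp_mem := leqCofinal_comp

/-! ### Skew Boolean spaces -/

/-- A Boolean space: locally compact, Hausdorff, with a base of clopen sets. -/
structure IsBooleanSpace (X : Type u) [TopologicalSpace X] : Prop where
  t2 : T2Space X
  locallyCompact : LocallyCompactSpace X
  zeroDim : TopologicalSpace.IsTopologicalBasis {U : Set X | IsClopen U}

/-- A skew Boolean space: a surjective étale map between Boolean spaces. -/
structure IsSkewBooleanSpace {E B : Type u} [TopologicalSpace E] [TopologicalSpace B]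
    (p : E → B) : Prop where
  total : IsBooleanSpace E
  base : IsBooleanSpace B
  etale : IsLocalHomeomorph p
  surjective : Function.Surjective p

/-- A proper continuous partial map with open domain of definition. `PContinuous` says that
inverse images of open sets are open, that is, that the domain is open and that the map is
continuous on it. -/
structure IsProperPartialMap {X Y : Type u} [TopologicalSpace X] [TopologicalSpace Y]
    (f : X →. Y) : Prop where
  continuous : PContinuous f
  proper : ∀ K : Set Y, IsCompact K → IsCompact (f.preimage K)

/-- The pair `(g, h)` is a morphism from `p` to `p'`. Commutativity means that `p` maps the domain
of `g` into that of `h` and that `p' ∘ g = h ∘ p` on the domain of `g`; the last field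
says that `g` maps `p ⁻¹ {b} ∩ dom g` bijectively onto the fiber of `p'` over `h b`, for
every `b` in the domain of `h`. -/
structure IsSkewMorphism {E B E' B' : Type u} [TopologicalSpace E] [TopologicalSpace B]
    [TopologicalSpace E'] [TopologicalSpace B'] (p : E → B) (p' : E' → B')
    (g : E →. E') (h : B →. B') : Prop where
  top : IsProperPartialMap g
  bot : IsProperPartialMap h
  comm : ∀ e e', e' ∈ g e → p' e' ∈ h (p e)
  bijOnFibers : ∀ b b', b' ∈ h b → ∀ e', p' e' = b' → ∃! e, p e = b ∧ e' ∈ g e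

theorem IsProperPartialMap.id (X : Type u) [TopologicalSpace X] :
    IsProperPartialMap (PFun.id X) := by
  have h : ∀ s : Set X, (PFun.id X).preimage s = s := fun s => by
    ext x; simp [PFun.mem_preimage]
  exact ⟨fun s hs => by rwa [h], fun K hK => by rwa [h]⟩

theorem IsProperPartialMap.comp {X Y Z : Type u} [TopologicalSpace X] [TopologicalSpace Y]
    [TopologicalSpace Z] {g : Y →. Z} {f : X →. Y} (hg : IsProperPartialMap g)
    (hf : IsProperPartialMap f) : IsProperPartialMap (g.comp f) :=
  ⟨fun s hs => by rw [PFun.preimage_comp]; exact hf.continuous _ (hg.continuous _ hs),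
    fun K hK => by rw [PFun.preimage_comp]; exact hf.proper _ (hg.proper _ hK)⟩

theorem PFun.mem_comp_iff {X Y Z : Type u} (g : Y →. Z) (f : X →. Y) (x : X) (z : Z) :
    z ∈ g.comp f x ↔ ∃ y ∈ f x, z ∈ g y := Part.mem_bind_iff

/-- Skew Boolean spaces. -/
structure SkewBooleanSpace : Type (u + 1) where
  E : Type u
  B : Type u
  [topE : TopologicalSpace E]
  [topB : TopologicalSpace B]
  p : E → B
  isSkew : IsSkewBooleanSpace p

attribute [instance] SkewBooleanSpace.topE SkewBooleanSpace.topB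

namespace SkewBooleanSpace

/-- Morphisms of skew Boolean spaces. -/
@[ext]
structure Hom (X Y : SkewBooleanSpace.{u}) where
  g : X.E →. Y.E
  h : X.B →. Y.B
  isMorphism : IsSkewMorphism X.p Y.p g h

/-- The identity morphism. -/
def Hom.id (X : SkewBooleanSpace.{u}) : Hom X X where
  g := PFun.id X.E
  h := PFun.id X.B
  isMorphism :=
    { top := IsProperPartialMap.id _
      bot := IsProperPartialMap.id _
      comm := fun e e' he => by
        have : e' = e := by simpa using he
        simp [this]
      bijOnFibers := fun b b' hb e' he' => by
        have hb : b' = b := by simpa using hb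
        subst hb
        refine ⟨e', ⟨he', by simp⟩, ?_⟩
        rintro e ⟨-, he⟩
        have : e' = e := by simpa using he
        exact this.symm }

/-- Composition of morphisms. -/
def Hom.comp {X Y Z : SkewBooleanSpace.{u}} (m : Hom X Y) (n : Hom Y Z) : Hom X Z where
  g := n.g.comp m.g
  h := n.h.comp m.h
  isMorphism :=
    { top := n.isMorphism.top.comp m.isMorphism.top
      bot := n.isMorphism.bot.comp m.isMorphism.bot
      comm := fun e e'' he => by
        rw [PFun.mem_comp_iff] at he
        obtain ⟨e', he', he''⟩ := he
        rw [PFun.mem_comp_iff]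
        exact ⟨_, m.isMorphism.comm _ _ he', n.isMorphism.comm _ _ he''⟩
      bijOnFibers := fun b b'' hb e'' he'' => by
        rw [PFun.mem_comp_iff] at hb
        obtain ⟨b', hb', hb''⟩ := hb
        obtain ⟨e', ⟨hpe', hge'⟩, hu'⟩ := n.isMorphism.bijOnFibers b' b'' hb'' e'' he''
        obtain ⟨e, ⟨hpe, hge⟩, hu⟩ := m.isMorphism.bijOnFibers b b' hb' e' hpe'
        refine ⟨e, ⟨hpe, ?_⟩, ?_⟩
        · rw [PFun.mem_comp_iff]
          exact ⟨e', hge, hge'⟩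
        · rintro x ⟨hpx, hx⟩
          rw [PFun.mem_comp_iff] at hx
          obtain ⟨y, hy, hy'⟩ := hx
          have h1 := m.isMorphism.comm _ _ hy
          rw [hpx] at h1
          have h2 : y = e' := hu' y ⟨Part.mem_unique h1 hb', hy'⟩
          exact hu x ⟨hpx, h2 ▸ hy⟩ }

/-- The category of skew Boolean spaces. -/
instance : Category.{u} SkewBooleanSpace.{u} where
  Hom := Hom
  id := Hom.id
  comp := Hom.comp
  id_comp _ := Hom.ext (PFun.comp_id _) (PFun.comp_id _)
  comp_id _ := Hom.ext (PFun.id_comp _) (PFun.id_comp _)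
  assoc _ _ _ := Hom.ext (PFun.comp_assoc _ _ _).symm (PFun.comp_assoc _ _ _).symm

/-- A morphism `(g, h)` is total when both `g` and `h` are defined everywhere. -/
def total : MorphismProperty SkewBooleanSpace.{u} := fun _ _ m =>
  (Hom.g m).Dom = Set.univ ∧ (Hom.h m).Dom = Set.univ

instance : (total.{u}).IsMultiplicative where
  id_mem X := ⟨rfl, rfl⟩
  comp_mem m n hm hn := by
    refine ⟨?_, ?_⟩
    · change ((Hom.g n).comp (Hom.g m)).Dom = Set.univ
      rw [PFun.dom_comp, hn.1, PFun.preimage_univ, hm.1]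
    · change ((Hom.h n).comp (Hom.h m)).Dom = Set.univ
      rw [PFun.dom_comp, hn.2, PFun.preimage_univ, hm.2]

/-- The projection as a bundled continuous map. -/
def proj (X : SkewBooleanSpace.{u}) : C(X.E, X.B) := ⟨X.p, X.isSkew.etale.continuous⟩

/-- The morphism `(g, h)` is a pullback square: `g` and `h` are everywhere defined continuous maps
and the resulting commutative square is a pullback of topological spaces. -/
def IsPullbackSquare {X Y : SkewBooleanSpace.{u}} (m : X ⟶ Y) : Prop :=
  ∃ (g : C(X.E, Y.E)) (h : C(X.B, Y.B)),
    Hom.g m = PFun.lift g ∧ Hom.h m = PFun.lift h ∧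
      IsPullback (TopCat.ofHom g) (TopCat.ofHom X.proj) (TopCat.ofHom Y.proj) (TopCat.ofHom h)

/-- A copen section of `p : E → B`, seen as a compact open subset of `E` on which `p` is
injective. -/
@[ext]
structure CopenSection (X : SkewBooleanSpace.{u}) : Type u where
  carrier : Set X.E
  isCompact : IsCompact carrier
  isOpen : IsOpen carrier
  injOn : Set.InjOn X.p carrier

/-- The saturation `p ⁻¹ (p S)`. -/
def sat (X : SkewBooleanSpace.{u}) (S : Set X.E) : Set X.E := X.p ⁻¹' (X.p '' S)

theorem isClopen_sat (X : SkewBooleanSpace.{u}) {S : Set X.E} (hc : IsCompact S) (ho : IsOpen S) :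
    IsClopen (X.sat S) := by
  have := X.isSkew.base.t2
  have hp := X.isSkew.etale.continuous
  exact ⟨(hc.image hp).isClosed.preimage hp, (X.isSkew.etale.isOpenMap _ ho).preimage hp⟩

namespace CopenSection

variable {X : SkewBooleanSpace.{u}}

instance : Zero (CopenSection X) := ⟨⟨∅, isCompact_empty, isOpen_empty, Set.injOn_empty _⟩⟩

instance : Min (CopenSection X) := ⟨fun S R =>
  ⟨X.sat S.carrier ∩ R.carrier,
    R.isCompact.inter_left (X.isClopen_sat S.isCompact S.isOpen).isClosed,
    (X.isClopen_sat S.isCompact S.isOpen).isOpen.inter R.isOpen,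
    R.injOn.mono Set.inter_subset_right⟩⟩

instance : Max (CopenSection X) := ⟨fun S R =>
  ⟨S.carrier ∪ (R.carrier \ X.sat S.carrier),
    S.isCompact.union (R.isCompact.diff (X.isClopen_sat S.isCompact S.isOpen).isOpen),
    S.isOpen.union (R.isOpen.sdiff (X.isClopen_sat S.isCompact S.isOpen).isClosed), by
      rintro a (ha | ⟨ha, ha'⟩) b (hb | ⟨hb, hb'⟩) hab
      · exact S.injOn ha hb hab
      · exact absurd ⟨a, ha, hab⟩ hb'
      · exact absurd ⟨b, hb, hab.symm⟩ ha'
      · exact R.injOn ha hb hab⟩⟩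

instance : SDiff (CopenSection X) := ⟨fun S R =>
  ⟨S.carrier \ X.sat R.carrier,
    S.isCompact.diff (X.isClopen_sat R.isCompact R.isOpen).isOpen,
    S.isOpen.sdiff (X.isClopen_sat R.isCompact R.isOpen).isClosed,
    S.injOn.mono Set.sdiff_subset⟩⟩

instance : Inter (CopenSection X) := ⟨fun S R =>
  ⟨S.carrier ∩ R.carrier,
    have := X.isSkew.total.t2
    S.isCompact.inter R.isCompact,
    S.isOpen.inter R.isOpen,
    S.injOn.mono Set.inter_subset_left⟩⟩

theorem mem_zero (e : X.E) : e ∈ (0 : CopenSection X).carrier ↔ False := Iff.rfl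

theorem mem_inf (S R : CopenSection X) (e : X.E) :
    e ∈ (S ⊓ R).carrier ↔ X.p e ∈ X.p '' S.carrier ∧ e ∈ R.carrier := Iff.rfl

theorem mem_sup (S R : CopenSection X) (e : X.E) :
    e ∈ (S ⊔ R).carrier ↔ e ∈ S.carrier ∨ (e ∈ R.carrier ∧ X.p e ∉ X.p '' S.carrier) := Iff.rfl

theorem mem_sdiff (S R : CopenSection X) (e : X.E) :
    e ∈ (S \ R).carrier ↔ e ∈ S.carrier ∧ X.p e ∉ X.p '' R.carrier := Iff.rfl

theorem mem_inter (S R : CopenSection X) (e : X.E) :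
    e ∈ (S ∩ R).carrier ↔ e ∈ S.carrier ∧ e ∈ R.carrier := Iff.rfl

theorem img_zero (b : X.B) : b ∈ X.p '' (0 : CopenSection X).carrier ↔ False :=
  ⟨fun ⟨_, h, _⟩ => h, False.elim⟩

theorem img_inf (S R : CopenSection X) (b : X.B) :
    b ∈ X.p '' (S ⊓ R).carrier ↔ b ∈ X.p '' S.carrier ∧ b ∈ X.p '' R.carrier := by
  constructor
  · rintro ⟨e, he, rfl⟩
    exact ⟨he.1, ⟨e, he.2, rfl⟩⟩
  · rintro ⟨hS, ⟨e, he, rfl⟩⟩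
    exact ⟨e, ⟨hS, he⟩, rfl⟩

theorem img_sup (S R : CopenSection X) (b : X.B) :
    b ∈ X.p '' (S ⊔ R).carrier ↔ b ∈ X.p '' S.carrier ∨ b ∈ X.p '' R.carrier := by
  constructor
  · rintro ⟨e, he | he, rfl⟩
    · exact Or.inl ⟨e, he, rfl⟩
    · exact Or.inr ⟨e, he.1, rfl⟩
  · intro h
    by_cases hS : b ∈ X.p '' S.carrier
    · obtain ⟨e, he, rfl⟩ := hS
      exact ⟨e, Or.inl he, rfl⟩
    · obtain ⟨e, he, rfl⟩ := h.resolve_left hS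
      exact ⟨e, Or.inr ⟨he, hS⟩, rfl⟩

theorem img_sdiff (S R : CopenSection X) (b : X.B) :
    b ∈ X.p '' (S \ R).carrier ↔ b ∈ X.p '' S.carrier ∧ b ∉ X.p '' R.carrier := by
  constructor
  · rintro ⟨e, he, rfl⟩
    exact ⟨⟨e, he.1, rfl⟩, he.2⟩
  · rintro ⟨⟨e, he, rfl⟩, hR⟩
    exact ⟨e, ⟨he, hR⟩, rfl⟩

theorem img_of_mem {S : CopenSection X} {e : X.E} (h : e ∈ S.carrier) :
    X.p e ∈ X.p '' S.carrier := ⟨e, h, rfl⟩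

instance : SkewLattice (CopenSection X) where
  inf_idem S := by
    ext e; have := @img_of_mem X S e; simp only [mem_inf]; tauto
  sup_idem S := by
    ext e; simp only [mem_sup]; tauto
  inf_assoc S R T := by
    ext e; simp only [mem_inf, img_inf]; tauto
  sup_assoc S R T := by
    ext e; simp only [mem_sup, img_sup]; tauto
  inf_sup_absorb S R := by
    ext e; have := @img_of_mem X S e; simp only [mem_inf, mem_sup]; tauto
  sup_inf_absorb' S R := by
    ext e; have := @img_of_mem X S e; simp only [mem_inf, img_sup]; tauto
  sup_inf_absorb S R := by
    ext e; simp only [mem_inf, mem_sup]; tauto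
  inf_sup_absorb' S R := by
    ext e; have := @img_of_mem X S e; simp only [mem_inf, mem_sup, img_inf]; tauto

/-- The natural partial order of copen sections is inclusion. -/
theorem natLE_iff (S R : CopenSection X) : NatLE S R ↔ S.carrier ⊆ R.carrier := by
  constructor
  · intro h e he
    rw [← h.1] at he
    exact he.2
  · intro h
    refine ⟨?_, ?_⟩
    · ext e
      rw [mem_inf]
      constructor
      · rintro ⟨⟨s, hs, hse⟩, he⟩
        exact R.injOn (h hs) he hse ▸ hs
      · exact fun he => ⟨img_of_mem he, h he⟩
    · ext e
      rw [mem_inf]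
      exact ⟨fun he => he.2, fun he => ⟨img_of_mem (h he), he⟩⟩

/-- The right-handed skew algebra of copen sections. -/
instance : SkewAlgebra (CopenSection X) where
  inf_sup_left S R T := by
    ext e; simp only [mem_inf, mem_sup, img_inf]; tauto
  inf_sup_right S R T := by
    ext e
    have := @img_of_mem X S e
    simp only [mem_inf, mem_sup, img_inf, img_sup]; tauto
  zero_sup S := by
    ext e; simp only [mem_sup, mem_zero, img_zero]; tauto
  sup_zero S := by
    ext e; simp only [mem_sup, mem_zero]; tauto
  sdiff_inf S R := by
    ext e; simp only [mem_inf, mem_zero, img_inf, img_sdiff]; tauto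
  sdiff_sup S R := by
    ext e
    have := @img_of_mem X S e
    simp only [mem_inf, mem_sup, mem_sdiff, img_inf, img_sdiff]; tauto
  inter_le_left S R := (natLE_iff _ _).2 Set.inter_subset_left
  inter_le_right S R := (natLE_iff _ _).2 Set.inter_subset_right
  le_inter S R T h1 h2 :=
    (natLE_iff _ _).2 (Set.subset_inter ((natLE_iff _ _).1 h1) ((natLE_iff _ _).1 h2))

end CopenSection

/-- The right-handed skew algebra `A_p` of copen sections of a skew Boolean space `p`. -/
def sectionAlg (X : SkewBooleanSpace.{u}) : RSkewAlg.{u} where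
  carrier := CopenSection X
  rightHanded S R := by
    ext e; have := @CopenSection.img_of_mem X S e
    simp only [CopenSection.mem_inf, CopenSection.img_inf]
    have := @CopenSection.img_of_mem X R e
    tauto

/-- The inverse image `g ⁻¹ S` of a copen section under a morphism `(g, h)`. -/
def Hom.pull {X Y : SkewBooleanSpace.{u}} (m : Hom X Y) (S : CopenSection Y) : CopenSection X where
  carrier := m.g.preimage S.carrier
  isCompact := m.isMorphism.top.proper _ S.isCompact
  isOpen := m.isMorphism.top.continuous _ S.isOpen
  injOn := by
    rintro a ⟨a', ha', ha⟩ b ⟨b', hb', hb⟩ hab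
    have ha : a' ∈ m.g a := ha
    have hb : b' ∈ m.g b := hb
    have h1 := m.isMorphism.comm _ _ ha
    have h2 := m.isMorphism.comm _ _ hb
    rw [hab] at h1
    have h3 : a' = b' := S.injOn ha' hb' (Part.mem_unique h1 h2)
    subst h3
    exact (m.isMorphism.bijOnFibers _ _ h2 a' rfl).unique ⟨hab, ha⟩ ⟨rfl, hb⟩

theorem Hom.mem_pull {X Y : SkewBooleanSpace.{u}} (m : Hom X Y) (S : CopenSection Y) (e : X.E) :
    e ∈ (m.pull S).carrier ↔ ∃ e' ∈ S.carrier, e' ∈ m.g e := Iff.rfl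

theorem Hom.img_pull {X Y : SkewBooleanSpace.{u}} (m : Hom X Y) (S : CopenSection Y) (b : X.B) :
    b ∈ X.p '' (m.pull S).carrier ↔ ∃ b' ∈ Y.p '' S.carrier, b' ∈ m.h b := by
  constructor
  · rintro ⟨e, ⟨e', he', he⟩, rfl⟩
    exact ⟨_, ⟨e', he', rfl⟩, m.isMorphism.comm _ _ he⟩
  · rintro ⟨_, ⟨e', he', rfl⟩, hb⟩
    obtain ⟨e, ⟨hpe, hge⟩, -⟩ := m.isMorphism.bijOnFibers _ _ hb e' rfl
    exact ⟨e, ⟨e', he', hge⟩, hpe⟩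

theorem Hom.img_pull_of_mem {X Y : SkewBooleanSpace.{u}} (m : Hom X Y) (S : CopenSection Y)
    {e : X.E} {e' : Y.E} (h : e' ∈ m.g e) :
    X.p e ∈ X.p '' (m.pull S).carrier ↔ Y.p e' ∈ Y.p '' S.carrier := by
  rw [Hom.img_pull]
  have h1 := m.isMorphism.comm _ _ h
  constructor
  · rintro ⟨b', hb', hb⟩
    exact Part.mem_unique h1 hb ▸ hb'
  · exact fun h2 => ⟨_, h2, h1⟩

/-- Membership in `g ⁻¹ S` at a point where `g` is defined. -/
theorem Hom.mem_pull_of_mem {X Y : SkewBooleanSpace.{u}} (m : Hom X Y) (S : CopenSection Y)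
    {e : X.E} {e' : Y.E} (h : e' ∈ m.g e) :
    e ∈ (m.pull S).carrier ↔ e' ∈ S.carrier := by
  rw [Hom.mem_pull]
  exact ⟨fun ⟨e'', h1, h2⟩ => Part.mem_unique h h2 ▸ h1, fun h1 => ⟨e', h1, h⟩⟩

theorem Hom.pull_ext {X Y : SkewBooleanSpace.{u}} (m : Hom X Y) {S T : CopenSection X}
    (hS : S.carrier ⊆ m.g.Dom) (hT : T.carrier ⊆ m.g.Dom)
    (h : ∀ e e', e' ∈ m.g e → (e ∈ S.carrier ↔ e ∈ T.carrier)) : S = T := by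
  ext e
  by_cases he : e ∈ m.g.Dom
  · obtain ⟨e', he'⟩ := (PFun.mem_dom _ _).1 he
    exact h e e' he'
  · exact ⟨fun h => absurd (hS h) he, fun h => absurd (hT h) he⟩

theorem Hom.pull_subset {X Y : SkewBooleanSpace.{u}} (m : Hom X Y) (S : CopenSection Y) :
    (m.pull S).carrier ⊆ m.g.Dom := PFun.preimage_subset_dom _ _

/-- The homomorphism `S ↦ g ⁻¹ S` induced by a morphism `(g, h)`. -/
def Hom.pullHom {X Y : SkewBooleanSpace.{u}} (m : Hom X Y) :
    SkewHom (CopenSection Y) (CopenSection X) where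
  toFun := m.pull
  map_zero := by
    ext e; rw [Hom.mem_pull]
    exact ⟨fun ⟨_, h, _⟩ => h, fun h => h.elim⟩
  map_inf S R := by
    refine m.pull_ext (m.pull_subset _) (fun e he => m.pull_subset R he.2) fun e e' h => ?_
    rw [m.mem_pull_of_mem _ h, CopenSection.mem_inf, CopenSection.mem_inf,
      m.mem_pull_of_mem _ h, m.img_pull_of_mem _ h]
  map_sup S R := by
    refine m.pull_ext (m.pull_subset _) ?_ fun e e' h => ?_
    · rintro e (he | he)
      · exact m.pull_subset S he
      · exact m.pull_subset R he.1
    · rw [m.mem_pull_of_mem _ h, CopenSection.mem_sup, CopenSection.mem_sup,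
        m.mem_pull_of_mem _ h, m.mem_pull_of_mem _ h, m.img_pull_of_mem _ h]
  map_sdiff S R := by
    refine m.pull_ext (m.pull_subset _) (fun e he => m.pull_subset S he.1) fun e e' h => ?_
    rw [m.mem_pull_of_mem _ h, CopenSection.mem_sdiff, CopenSection.mem_sdiff,
      m.mem_pull_of_mem _ h, m.img_pull_of_mem _ h]
  map_inter S R := by
    refine m.pull_ext (m.pull_subset _) (fun e he => m.pull_subset S he.1) fun e e' h => ?_
    rw [m.mem_pull_of_mem _ h, CopenSection.mem_inter, CopenSection.mem_inter,
      m.mem_pull_of_mem _ h, m.mem_pull_of_mem _ h]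

/-- The contravariant functor from skew Boolean spaces to right-handed skew algebras, which sends
`p` to `A_p` and `(g, h)` to `S ↦ g ⁻¹ S`. -/
def sectionFunctor : SkewBooleanSpace.{u}ᵒᵖ ⥤ RSkewAlg.{u} where
  obj X := sectionAlg X.unop
  map m := Hom.pullHom m.unop
  map_id X := by
    refine SkewHom.ext (funext fun S => CopenSection.ext ?_)
    ext e
    change e ∈ (PFun.id X.unop.E).preimage (CopenSection.carrier S) ↔ _
    simp only [PFun.mem_preimage, PFun.id_apply, Part.mem_some_iff, exists_eq_right]
    rfl
  map_comp m n := by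
    refine SkewHom.ext (funext fun S => CopenSection.ext ?_)
    exact PFun.preimage_comp _ _ _

end SkewBooleanSpace

/-! ### The skew spectrum -/

/-- A (`⪯`-)ideal of a skew algebra. -/
structure IsSkewIdeal {A : Type u} [SkewAlgebra A] (I : Set A) : Prop where
  zero_mem : (0 : A) ∈ I
  sup_mem : ∀ x ∈ I, ∀ y ∈ I, x ⊔ y ∈ I
  lower : ∀ x y : A, NatPreLE x y → y ∈ I → x ∈ I

/-- A prime ideal of a skew algebra. -/
structure IsPrimeSkewIdeal {A : Type u} [SkewAlgebra A] (P : Set A) : Prop where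
  isIdeal : IsSkewIdeal P
  ne_univ : P ≠ Set.univ
  prime : ∀ x y : A, x ⊓ y ∈ P → x ∈ P ∨ y ∈ P

theorem IsPrimeSkewIdeal.preimage {A A' : Type u} [SkewAlgebra A] [SkewAlgebra A']
    (f : SkewHom A A') {P : Set A'} (hP : IsPrimeSkewIdeal P) (h : f.toFun ⁻¹' P ≠ Set.univ) :
    IsPrimeSkewIdeal (f.toFun ⁻¹' P) where
  isIdeal :=
    { zero_mem := by
        change f.toFun 0 ∈ P
        rw [f.map_zero]; exact hP.isIdeal.zero_mem
      sup_mem := fun x hx y hy => by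
        change f.toFun (x ⊔ y) ∈ P
        rw [f.map_sup]; exact hP.isIdeal.sup_mem _ hx _ hy
      lower := fun x y hxy hy => by
        refine hP.isIdeal.lower (f.toFun x) (f.toFun y) ?_ hy
        change f.toFun x ⊓ f.toFun y ⊓ f.toFun x = f.toFun x
        rw [← f.map_inf, ← f.map_inf, hxy] }
  ne_univ := h
  prime x y hxy := by
    change f.toFun (x ⊓ y) ∈ P at hxy
    rw [f.map_inf] at hxy
    exact hP.prime _ _ hxy

/-- A congruence relation of a skew algebra. -/
structure IsSkewCongruence {A : Type u} [SkewAlgebra A] (r : A → A → Prop) : Prop where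
  equiv : Equivalence r
  inf : ∀ x x' y y', r x x' → r y y' → r (x ⊓ y) (x' ⊓ y')
  sup : ∀ x x' y y', r x x' → r y y' → r (x ⊔ y) (x' ⊔ y')
  sdiff : ∀ x x' y y', r x x' → r y y' → r (x \ y) (x' \ y')
  inter : ∀ x x' y y', r x x' → r y y' → r (x ∩ y) (x' ∩ y')

/-- The congruence `θ_I`: the least congruence whose zero-class contains `I`. -/
def theta {A : Type u} [SkewAlgebra A] (I : Set A) : Setoid A where
  r x y := ∀ r : A → A → Prop, IsSkewCongruence r → (∀ i ∈ I, r i 0) → r x y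
  iseqv :=
    { refl := fun x _ hr _ => hr.equiv.refl x
      symm := fun h r hr hI => hr.equiv.symm (h r hr hI)
      trans := fun h1 h2 r hr hI => hr.equiv.trans (h1 r hr hI) (h2 r hr hI) }

/-- The spectrum, whose points are the prime ideals. (The prime ideals of a skew algebra correspond
to those of its lattice reflection.) -/
@[ext]
structure St (A : Type u) [SkewAlgebra A] : Type u where
  ideal : Set A
  isPrime : IsPrimeSkewIdeal ideal

/-- The basic set `N_a = {P | a ∉ P}`. -/
def St.basic {A : Type u} [SkewAlgebra A] (a : A) : Set (St A) := {P | a ∉ P.ideal}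

instance (A : Type u) [SkewAlgebra A] : TopologicalSpace (St A) :=
  TopologicalSpace.generateFrom (Set.range St.basic)

/-- The skew spectrum, whose points are the pairs `P_t = (P, [t])`, where `P` is a prime ideal,
`t ∉ P` and `[t]` is the class of `t` modulo `θ_P`. -/
structure Sk (A : Type u) [SkewAlgebra A] : Type u where
  prime : St A
  cls : Quotient (theta prime.ideal)
  exists_rep : ∃ t, t ∉ prime.ideal ∧ cls = Quotient.mk _ t

/-- The point `P_t` of the skew spectrum. -/
def Sk.mkPoint {A : Type u} [SkewAlgebra A] (P : St A) (t : A) (ht : t ∉ P.ideal) : Sk A :=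
  ⟨P, Quotient.mk _ t, t, ht, rfl⟩

/-- The basic set `M_a = {P_a | a ∉ P}`. -/
def Sk.basic {A : Type u} [SkewAlgebra A] (a : A) : Set (Sk A) :=
  {x | ∃ (P : St A) (h : a ∉ P.ideal), x = Sk.mkPoint P a h}

instance (A : Type u) [SkewAlgebra A] : TopologicalSpace (Sk A) :=
  TopologicalSpace.generateFrom (Set.range Sk.basic)

/-- The partial map on spectra induced by a homomorphism `f`: it sends `P` to `f ⁻¹ P`, provided
that this is not the whole algebra. -/
def SkewHom.down {A A' : Type u} [SkewAlgebra A] [SkewAlgebra A'] (f : SkewHom A A') :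
    St A' →. St A := fun P =>
  ⟨f.toFun ⁻¹' P.ideal ≠ Set.univ, fun h => ⟨f.toFun ⁻¹' P.ideal, P.isPrime.preimage f h⟩⟩

theorem SkewHom.preimage_ne_univ {A A' : Type u} [SkewAlgebra A] [SkewAlgebra A']
    (f : SkewHom A A') {P : Set A'} {a : A} (ha : f.toFun a ∉ P) :
    f.toFun ⁻¹' P ≠ Set.univ := fun h => ha (h ▸ Set.mem_univ a : a ∈ f.toFun ⁻¹' P)

/-- The partial map on skew spectra induced by a homomorphism `f`: it is defined at the points of
the form `P_{f a}` with `f a ∉ P`, and it sends `P_{f a}` to `(f ⁻¹ P)_a`. -/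
noncomputable def SkewHom.up {A A' : Type u} [SkewAlgebra A] [SkewAlgebra A'] (f : SkewHom A A') :
    Sk A' →. Sk A := fun x =>
  ⟨∃ a : A, ∃ h : f.toFun a ∉ x.prime.ideal, x = Sk.mkPoint x.prime (f.toFun a) h,
    fun h => Sk.mkPoint
      ⟨f.toFun ⁻¹' x.prime.ideal,
        x.prime.isPrime.preimage f (f.preimage_ne_univ h.choose_spec.choose)⟩
      h.choose h.choose_spec.choose⟩

/-- The assertion that the skew spectrum is a well defined contravariant functor from right-handed
skew algebras to skew Boolean spaces: `Sk A → St A` is a skew Boolean space, the value of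
`up f` at `P_{f a}` does not depend on the representative `a`, the pair `(up f, down f)` is a
morphism, and identities and composites are preserved. -/
structure SpectrumWellDefined : Prop where
  isSkew : ∀ A : RSkewAlg.{u}, IsSkewBooleanSpace (Sk.prime : Sk A.carrier → St A.carrier)
  up_mkPoint : ∀ {A A' : RSkewAlg.{u}} (f : SkewHom A.carrier A'.carrier) (P : St A'.carrier)
    (a : A.carrier) (h : f.toFun a ∉ P.ideal),
    Sk.mkPoint ⟨f.toFun ⁻¹' P.ideal, P.isPrime.preimage f (f.preimage_ne_univ h)⟩ a h ∈
      f.up (Sk.mkPoint P (f.toFun a) h)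
  isMorphism : ∀ {A A' : RSkewAlg.{u}} (f : SkewHom A.carrier A'.carrier),
    IsSkewMorphism (Sk.prime : Sk A'.carrier → St A'.carrier)
      (Sk.prime : Sk A.carrier → St A.carrier) f.up f.down
  up_id : ∀ A : RSkewAlg.{u}, (SkewHom.id A.carrier).up = PFun.id _
  down_id : ∀ A : RSkewAlg.{u}, (SkewHom.id A.carrier).down = PFun.id _
  up_comp : ∀ {A A' A'' : RSkewAlg.{u}} (f : SkewHom A.carrier A'.carrier)
    (g : SkewHom A'.carrier A''.carrier), (g.comp f).up = f.up.comp g.up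
  down_comp : ∀ {A A' A'' : RSkewAlg.{u}} (f : SkewHom A.carrier A'.carrier)
    (g : SkewHom A'.carrier A''.carrier), (g.comp f).down = f.down.comp g.down

/-- The contravariant functor which sends `A` to `Sk A → St A` and `f` to `(up f, down f)`. -/
noncomputable def spectrumFunctor (w : SpectrumWellDefined.{u}) :
    RSkewAlg.{u}ᵒᵖ ⥤ SkewBooleanSpace.{u} where
  obj A := ⟨Sk A.unop.carrier, St A.unop.carrier, Sk.prime, w.isSkew A.unop⟩
  map f := ⟨SkewHom.up f.unop, SkewHom.down f.unop, w.isMorphism f.unop⟩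
  map_id A := SkewBooleanSpace.Hom.ext (w.up_id A.unop) (w.down_id A.unop)
  map_comp f g := SkewBooleanSpace.Hom.ext (w.up_comp g.unop f.unop) (w.down_comp g.unop f.unop)

/-! ### Right-handed skew algebras -/

/-! The duality is Stone duality carried out fibrewise. Everything rests on an explicit form of
`θ_P` for a prime ideal `P`: two elements are congruent when both lie in `P` or their intersection
lies outside `P` (`theta_iff`, via `PrimeRel`). Modulo `P` each operation becomes zero or a
projection to one argument, according to membership in `P` or congruence. The sets `M_a` therefore
obey the same membership rules as copen sections (`Sk.mem_basic_inf` and its companions). Each `N_a`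
is compact because an ultrafilter containing it converges to a prime ideal, and `M_a` maps
homeomorphically onto `N_a`; this makes `q_A` a skew Boolean space.

A homomorphism preserves intersections, so it respects these congruences, and the inverse image of
`M_a` under `f^↑` is `M_{f a}` (`up_preimage_basic`). Continuity, properness and naturality of `a ↦
M_a` follow from this identity.

For the unit, a point `e` goes to the prime ideal of sections missing its fiber together with the
class of any section through `e`. Every prime ideal arises from a point of the base by compactness
(`exists_primeAt_eq`). For the counit `a ↦ M_a`, injectivity comes from the abundance of prime
ideals (`exists_prime_notMem`, by Zorn), and surjectivity from compactness, since the `M_a` inside a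
section are directed under joins.

Totality gives a pullback because the fiber bijections define the induced map, and étaleness makes
it continuous (`exists_continuous_lift`). A total `g` covers each section by restrictions of pulled
back sections, whence cofinality by compactness; conversely, the sections inside the domain of `g`
form a `≤`-ideal containing the image. Naturality and the invariance of both classes under
isomorphism transfer this to homomorphisms and restrict the equivalence. -/

/-- Right-handedness of a skew algebra. -/
class RightHanded (A : Type u) [SkewAlgebra A] : Prop where
  inf_inf_self : ∀ x y : A, x ⊓ y ⊓ x = y ⊓ x

instance (A : RSkewAlg.{u}) : RightHanded A.carrier := ⟨A.rightHanded⟩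

instance (X : SkewBooleanSpace.{u}) : RightHanded X.CopenSection :=
  ⟨X.sectionAlg.rightHanded⟩

namespace SkewAlgebra

section General

variable {A : Type u} [SkewAlgebra A]

theorem zero_inf (x : A) : (0 : A) ⊓ x = 0 := by
  have h := SkewLattice.inf_sup_absorb (0 : A) x
  rwa [SkewBooleanAlgebra.zero_sup] at h

theorem inf_zero (x : A) : x ⊓ (0 : A) = 0 := by
  have h := SkewLattice.sup_inf_absorb' (0 : A) x
  rwa [SkewBooleanAlgebra.sup_zero] at h

theorem sdiff_inf_self (x y : A) : (x \ y) ⊓ x = x \ y := by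
  have h := SkewLattice.inf_sup_absorb (x \ y) (x ⊓ y ⊓ x)
  rwa [SkewBooleanAlgebra.sdiff_sup] at h

theorem inter_eq_of_natLE {x y : A} (h : NatLE x y) : x ∩ y = x := by
  have h1 := inter_le_left x y
  have h2 := le_inter x y x ⟨SkewLattice.inf_idem x, SkewLattice.inf_idem x⟩ h
  rw [← h1.1, h2.2]

end General

variable {A : Type u} [SkewAlgebra A] [RightHanded A]

theorem inf_inf_self (x y : A) : x ⊓ (y ⊓ x) = y ⊓ x := by
  rw [← SkewLattice.inf_assoc, RightHanded.inf_inf_self]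

theorem natLE_of_inf_eq {x y : A} (h : x ⊓ y = x) : NatLE x y :=
  ⟨h, by rw [← h, inf_inf_self]⟩

theorem natPreLE_iff {x y : A} : NatPreLE x y ↔ y ⊓ x = x := by
  rw [NatPreLE, RightHanded.inf_inf_self]

theorem sdiff_natLE (x y : A) : NatLE (x \ y) x := natLE_of_inf_eq (sdiff_inf_self x y)

theorem inf_natLE_right (x y : A) : NatLE (x ⊓ y) y :=
  natLE_of_inf_eq (by rw [SkewLattice.inf_assoc, SkewLattice.inf_idem])

theorem natLE_sup_left (x y : A) : NatLE x (x ⊔ y) := natLE_of_inf_eq (SkewLattice.inf_sup_absorb x y)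

theorem NatLE.natPreLE {x y : A} (h : NatLE x y) : NatPreLE x y := natPreLE_iff.2 h.2

theorem natLE_trans {x y z : A} (h : NatLE x y) (h' : NatLE y z) : NatLE x z :=
  natLE_of_inf_eq (by rw [← h.1, SkewLattice.inf_assoc, h'.1])

theorem natPreLE_trans {x y z : A} (h : NatPreLE x y) (h' : NatPreLE y z) : NatPreLE x z := by
  rw [natPreLE_iff] at *
  rw [← h, ← SkewLattice.inf_assoc, h']

theorem natPreLE_sup_left (x y : A) : NatPreLE x (x ⊔ y) := NatLE.natPreLE (natLE_sup_left x y)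

theorem natPreLE_sup_right (x y : A) : NatPreLE y (x ⊔ y) := natPreLE_iff.2 (SkewLattice.sup_inf_absorb' y x)

theorem sup_natPreLE {x y z : A} (hx : NatPreLE x z) (hy : NatPreLE y z) : NatPreLE (x ⊔ y) z := by
  rw [natPreLE_iff] at *
  rw [SkewBooleanAlgebra.inf_sup_left, hx, hy]

theorem natPreLE_inf {x y z : A} (hy : NatPreLE x y) (hz : NatPreLE x z) : NatPreLE x (y ⊓ z) := by
  rw [natPreLE_iff] at *
  rw [SkewLattice.inf_assoc, hz, hy]

theorem inf_natPreLE_left (x y : A) : NatPreLE (x ⊓ y) x :=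
  natPreLE_iff.2 (by rw [← SkewLattice.inf_assoc, SkewLattice.inf_idem])

theorem inf_natPreLE_right (x y : A) : NatPreLE (x ⊓ y) y := NatLE.natPreLE (inf_natLE_right x y)

/-- Two elements below `z` which generate the same principal `⪯`-ideal are equal. -/
theorem eq_of_natLE_of_inf_eq {u v z : A} (hu : NatLE u z) (hv : NatLE v z) (huv : u ⊓ v = v)
    (hvu : v ⊓ u = u) : u = v := by
  -- Split `z` into `u` and its relative complement. Since `v` is `⪯`-below `u`, it meets the
  -- complement in `0`, so `v = v ⊓ z` collapses to `v ⊓ u`.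
  have hz : (z \ u) ⊔ u = z := by
    have h := SkewBooleanAlgebra.sdiff_sup z u
    rwa [hu.2, hu.1] at h
  have hwu : (z \ u) ⊓ u = 0 := by
    have h := SkewBooleanAlgebra.sdiff_inf z u
    rwa [hu.2, hu.1] at h
  have hvw : v ⊓ (z \ u) = 0 := by
    rw [← inf_inf_self (z \ u) v, ← huv, ← SkewLattice.inf_assoc, ← SkewLattice.inf_assoc, hwu, zero_inf, zero_inf]
  have h := hv.1
  rw [← hz, SkewBooleanAlgebra.inf_sup_left, hvw, SkewBooleanAlgebra.zero_sup, hvu] at h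
  exact h

/-- Right normality. -/
theorem inf_inf_comm (x y z : A) : x ⊓ (y ⊓ z) = y ⊓ (x ⊓ z) := by
  -- Both sides are `≤`-below `z` and each is `⪯`-below the other, so `eq_of_natLE_of_inf_eq`
  -- identifies them.
  have key : ∀ x y z : A, (x ⊓ (y ⊓ z)) ⊓ (y ⊓ (x ⊓ z)) = y ⊓ (x ⊓ z) := by
    intro x y z
    calc (x ⊓ (y ⊓ z)) ⊓ (y ⊓ (x ⊓ z)) = x ⊓ (y ⊓ (z ⊓ (y ⊓ (x ⊓ z)))) := by
          simp only [SkewLattice.inf_assoc]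
      _ = x ⊓ (y ⊓ (y ⊓ (x ⊓ z))) := by
          rw [← SkewLattice.inf_assoc y x z, inf_inf_self]
      _ = x ⊓ ((y ⊓ x) ⊓ z) := by rw [← SkewLattice.inf_assoc y y, SkewLattice.inf_idem, ← SkewLattice.inf_assoc y x z]
      _ = y ⊓ (x ⊓ z) := by rw [← SkewLattice.inf_assoc x, inf_inf_self, SkewLattice.inf_assoc]
  have hle : ∀ x y z : A, NatLE (x ⊓ (y ⊓ z)) z := fun x y z =>
    natLE_of_inf_eq (by simp only [SkewLattice.inf_assoc, SkewLattice.inf_idem])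
  exact eq_of_natLE_of_inf_eq (hle _ _ _) (hle _ _ _) (key _ _ _) (key _ _ _)

/-- A common upper bound makes the two elements commute under meet, by right normality. -/
theorem inf_natLE_left_of_natLE {x y z : A} (hx : NatLE x z) (hy : NatLE y z) :
    NatLE (x ⊓ y) x := by
  have h : x ⊓ y = y ⊓ x := by
    rw [← hy.1, inf_inf_comm, hx.1, hy.1]
  rw [h]
  exact inf_natLE_right y x

theorem sdiff_inf_eq_zero (x y : A) : (x \ y) ⊓ y = 0 := by
  have h := SkewBooleanAlgebra.sdiff_inf x y
  rw [RightHanded.inf_inf_self, inf_inf_comm, sdiff_inf_self] at h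
  rw [← inf_inf_self y, ← SkewLattice.inf_assoc, h, zero_inf]

theorem sdiff_sup_inf (x y : A) : (x \ y) ⊔ (y ⊓ x) = x := by
  rw [← RightHanded.inf_inf_self x y, SkewBooleanAlgebra.sdiff_sup]

/-- In `y ⊔ x` the first argument takes precedence, so only the part of `x` off `y` survives as a
`≤`-lower bound. It serves as the common lower bound in `PrimeRel.sup_of_mem`. -/
theorem sdiff_natLE_sup (x y : A) : NatLE (x \ y) (y ⊔ x) :=
  natLE_of_inf_eq (by rw [SkewBooleanAlgebra.inf_sup_left, sdiff_inf_eq_zero, SkewBooleanAlgebra.zero_sup, sdiff_inf_self])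

end SkewAlgebra

/-! ### Prime ideals -/

namespace IsPrimeSkewIdeal

open SkewAlgebra

variable {A : Type u} [SkewAlgebra A] [RightHanded A] {P : Set A}

theorem inf_mem_iff (hP : IsPrimeSkewIdeal P) {x y : A} : x ⊓ y ∈ P ↔ x ∈ P ∨ y ∈ P :=
  ⟨hP.prime x y, fun h => h.elim (hP.isIdeal.lower _ _ (inf_natPreLE_left x y))
    (hP.isIdeal.lower _ _ (inf_natPreLE_right x y))⟩

theorem sup_mem_iff (hP : IsPrimeSkewIdeal P) {x y : A} : x ⊔ y ∈ P ↔ x ∈ P ∧ y ∈ P :=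
  ⟨fun h => ⟨hP.isIdeal.lower _ _ (natPreLE_sup_left x y) h,
    hP.isIdeal.lower _ _ (natPreLE_sup_right x y) h⟩, fun h => hP.isIdeal.sup_mem _ h.1 _ h.2⟩

theorem mem_of_natLE (hP : IsPrimeSkewIdeal P) {x y : A} (h : NatLE x y) (hy : y ∈ P) : x ∈ P :=
  hP.isIdeal.lower _ _ (NatLE.natPreLE h) hy

/-- Apply primeness to `(x \ y) ⊓ y = 0` and join closure to `x = (x \ y) ⊔ (y ⊓ x)`. -/
theorem sdiff_mem_iff (hP : IsPrimeSkewIdeal P) {x y : A} : x \ y ∈ P ↔ x ∈ P ∨ y ∉ P := by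
  constructor
  · intro h
    by_contra! hn
    refine hn.1 ?_
    rw [← sdiff_sup_inf x y, hP.sup_mem_iff, hP.inf_mem_iff]
    exact ⟨h, Or.inl hn.2⟩
  · rintro (h | h)
    · exact hP.mem_of_natLE (sdiff_natLE x y) h
    · have h0 : (x \ y) ⊓ y ∈ P := by rw [sdiff_inf_eq_zero]; exact hP.isIdeal.zero_mem
      exact (hP.prime _ _ h0).resolve_right h

theorem inter_notMem_of_natLE (hP : IsPrimeSkewIdeal P) {c x y : A} (hc : c ∉ P)
    (hx : NatLE c x) (hy : NatLE c y) : x ∩ y ∉ P :=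
  fun h => hc (hP.mem_of_natLE (SkewAlgebra.le_inter _ _ _ hx hy) h)

end IsPrimeSkewIdeal

/-! ### The congruence attached to a prime ideal. -/

/-- The explicit description of the congruence `θ_P` of a prime ideal. -/
def PrimeRel {A : Type u} [SkewAlgebra A] (P : Set A) (x y : A) : Prop :=
  (x ∈ P ∧ y ∈ P) ∨ x ∩ y ∉ P

namespace PrimeRel

open SkewAlgebra

theorem refl {A : Type u} [SkewAlgebra A] {P : Set A} (x : A) : PrimeRel P x x := by
  by_cases hx : x ∈ P
  · exact Or.inl ⟨hx, hx⟩
  · refine Or.inr ?_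
    rwa [inter_eq_of_natLE ⟨SkewLattice.inf_idem x, SkewLattice.inf_idem x⟩]

variable {A : Type u} [SkewAlgebra A] [RightHanded A] {P : Set A}

theorem of_natLE (hP : IsPrimeSkewIdeal P) {c x y : A} (hc : c ∉ P)
    (hx : NatLE c x) (hy : NatLE c y) : PrimeRel P x y :=
  Or.inr (hP.inter_notMem_of_natLE hc hx hy)

theorem mem_iff (hP : IsPrimeSkewIdeal P) {x y : A} (h : PrimeRel P x y) : x ∈ P ↔ y ∈ P := by
  rcases h with ⟨hx, hy⟩ | h
  · exact iff_of_true hx hy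
  · exact iff_of_false (fun hx => h (hP.mem_of_natLE (inter_le_left x y) hx))
      (fun hy => h (hP.mem_of_natLE (inter_le_right x y) hy))

theorem symm (hP : IsPrimeSkewIdeal P) {x y : A} (h : PrimeRel P x y) : PrimeRel P y x := by
  rcases h with ⟨hx, hy⟩ | h
  · exact Or.inl ⟨hy, hx⟩
  · exact of_natLE hP h (inter_le_right x y) (inter_le_left x y)

theorem trans (hP : IsPrimeSkewIdeal P) {x y z : A} (h : PrimeRel P x y) (h' : PrimeRel P y z) :
    PrimeRel P x z := by
  by_cases hy : y ∈ P
  · exact Or.inl ⟨(h.mem_iff hP).2 hy, (h'.mem_iff hP).1 hy⟩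
  · have h1 : x ∩ y ∉ P := h.resolve_left fun h => hy h.2
    have h2 : y ∩ z ∉ P := h'.resolve_left fun h => hy h.1
    -- Both intersections lie below `y`, so their meet is below each of them and hence below `x` and
    -- `z`; primeness keeps it outside `P`.
    refine of_natLE hP (c := (x ∩ y) ⊓ (y ∩ z)) ?_ ?_ ?_
    · rw [hP.inf_mem_iff]; tauto
    · exact natLE_trans (inf_natLE_left_of_natLE (inter_le_right x y) (inter_le_left y z))
        (inter_le_left x y)
    · exact natLE_trans (inf_natLE_right _ _) (inter_le_right y z)

/-- This lemma and those that follow, up to `inter_left`, reduce an operation modulo `P` to one of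
its arguments, the remaining cases landing in `P`. -/
theorem inf_of_notMem (hP : IsPrimeSkewIdeal P) {x y : A} (hx : x ∉ P) :
    PrimeRel P (x ⊓ y) y := by
  by_cases hy : y ∈ P
  · exact Or.inl ⟨hP.inf_mem_iff.2 (Or.inr hy), hy⟩
  · refine of_natLE hP (c := x ⊓ y) ?_ ⟨SkewLattice.inf_idem _, SkewLattice.inf_idem _⟩
      (inf_natLE_right x y)
    rw [hP.inf_mem_iff]; tauto

theorem sup_of_notMem (hP : IsPrimeSkewIdeal P) {x y : A} (hx : x ∉ P) :
    PrimeRel P (x ⊔ y) x :=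
  of_natLE hP hx (natLE_sup_left x y) ⟨SkewLattice.inf_idem _, SkewLattice.inf_idem _⟩

theorem sdiff_of_mem (hP : IsPrimeSkewIdeal P) {x y : A} (hy : y ∈ P) : PrimeRel P (x \ y) x := by
  by_cases hx : x ∈ P
  · exact Or.inl ⟨hP.sdiff_mem_iff.2 (Or.inl hx), hx⟩
  · refine of_natLE hP (c := x \ y) ?_ ⟨SkewLattice.inf_idem _, SkewLattice.inf_idem _⟩
      (sdiff_natLE x y)
    rw [hP.sdiff_mem_iff]; tauto

theorem sup_of_mem (hP : IsPrimeSkewIdeal P) {x y : A} (hx : x ∈ P) :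
    PrimeRel P (x ⊔ y) y := by
  by_cases hy : y ∈ P
  · exact Or.inl ⟨hP.sup_mem_iff.2 ⟨hx, hy⟩, hy⟩
  · refine of_natLE hP (c := y \ x) ?_ (sdiff_natLE_sup y x) (sdiff_natLE y x)
    rw [hP.sdiff_mem_iff]; tauto

theorem inter_left (hP : IsPrimeSkewIdeal P) {x y : A} (h : PrimeRel P x y) :
    PrimeRel P (x ∩ y) x := by
  rcases h with ⟨hx, hy⟩ | h
  · exact Or.inl ⟨hP.mem_of_natLE (inter_le_left x y) hx, hx⟩
  · exact of_natLE hP h ⟨SkewLattice.inf_idem _, SkewLattice.inf_idem _⟩ (inter_le_left x y)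

/-- Related arguments fall under the same case of the projection rules, so compatibility reduces to
the equivalence properties. -/
theorem isSkewCongruence (hP : IsPrimeSkewIdeal P) : IsSkewCongruence (PrimeRel P) where
  equiv := ⟨refl, fun h => h.symm hP, fun h h' => h.trans hP h'⟩
  inf x x' y y' hx hy := by
    by_cases h : x ∈ P
    · exact Or.inl ⟨hP.inf_mem_iff.2 (Or.inl h),
        hP.inf_mem_iff.2 (Or.inl ((hx.mem_iff hP).1 h))⟩
    · have h' := mt (hx.mem_iff hP).2 h
      exact ((inf_of_notMem hP h).trans hP hy).trans hP ((inf_of_notMem hP h').symm hP)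
  sup x x' y y' hx hy := by
    by_cases h : x ∈ P
    · have h' := (hx.mem_iff hP).1 h
      exact ((sup_of_mem hP h).trans hP hy).trans hP ((sup_of_mem hP h').symm hP)
    · have h' := mt (hx.mem_iff hP).2 h
      exact ((sup_of_notMem hP h).trans hP hx).trans hP ((sup_of_notMem hP h').symm hP)
  sdiff x x' y y' hx hy := by
    by_cases h : y ∈ P
    · have h' := (hy.mem_iff hP).1 h
      exact ((sdiff_of_mem hP h).trans hP hx).trans hP ((sdiff_of_mem hP h').symm hP)
    · have h' := mt (hy.mem_iff hP).2 h
      exact Or.inl ⟨hP.sdiff_mem_iff.2 (Or.inr h), hP.sdiff_mem_iff.2 (Or.inr h')⟩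
  inter x x' y y' hx hy := by
    by_cases h : PrimeRel P x y
    · have h' : PrimeRel P x' y' := ((hx.symm hP).trans hP h).trans hP hy
      exact ((h.inter_left hP).trans hP hx).trans hP ((h'.inter_left hP).symm hP)
    · have h' : ¬ PrimeRel P x' y' := fun h' => h ((hx.trans hP h').trans hP (hy.symm hP))
      exact Or.inl ⟨not_not.1 fun hn => h (Or.inr hn), not_not.1 fun hn => h' (Or.inr hn)⟩

end PrimeRel

/-! ### Identification of `θ_P`, and enough prime ideals. -/

namespace SkewAlgebra

variable {A : Type u} [SkewAlgebra A] [RightHanded A]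

theorem theta_iff {P : Set A} (hP : IsPrimeSkewIdeal P) {x y : A} :
    (theta P) x y ↔ PrimeRel P x y := by
  constructor
  · refine fun h => h _ (PrimeRel.isSkewCongruence hP) fun i hi => ?_
    exact Or.inl ⟨hi, hP.isIdeal.zero_mem⟩
  · intro h r hr hr0
    rcases h with ⟨hx, hy⟩ | h
    · exact hr.equiv.trans (hr0 _ hx) (hr.equiv.symm (hr0 _ hy))
    · have key : ∀ z, NatLE (x ∩ y) z → r z (x ∩ y) := by
        intro z hz
        have h1 : (z \ (x ∩ y)) ⊔ (x ∩ y) = z := by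
          have h := sdiff_sup_inf z (x ∩ y)
          rwa [hz.1] at h
        have h2 := hr.sup _ _ _ _ (hr0 (z \ (x ∩ y)) (hP.sdiff_mem_iff.2 (Or.inr h)))
          (hr.equiv.refl (x ∩ y))
        rwa [h1, SkewBooleanAlgebra.zero_sup] at h2
      exact hr.equiv.trans (key _ (inter_le_left x y)) (hr.equiv.symm (key _ (inter_le_right x y)))

/-- The ideal generated by an ideal and one more element. -/
theorem isSkewIdeal_adjoin {I : Set A} (hI : IsSkewIdeal I) (x : A) :
    IsSkewIdeal {z | ∃ m ∈ I, NatPreLE z (m ⊔ x)} where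
  zero_mem := ⟨0, hI.zero_mem, natPreLE_iff.2 (inf_zero _)⟩
  sup_mem := by
    rintro z ⟨m, hm, hz⟩ z' ⟨m', hm', hz'⟩
    refine ⟨m ⊔ m', hI.sup_mem _ hm _ hm', sup_natPreLE (natPreLE_trans hz ?_)
      (natPreLE_trans hz' ?_)⟩
    · exact sup_natPreLE (natPreLE_trans (natPreLE_sup_left m m') (natPreLE_sup_left _ _))
        (natPreLE_sup_right _ _)
    · exact sup_natPreLE (natPreLE_trans (natPreLE_sup_right m m') (natPreLE_sup_left _ _))
        (natPreLE_sup_right _ _)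
  lower := by
    rintro y z hyz ⟨m, hm, hz⟩
    exact ⟨m, hm, natPreLE_trans hyz hz⟩

/-- An ideal maximal among those missing `c` is prime: if it missed both `x` and `y`, then `c` would
be `⪯`-below some `m ⊔ x` and some `n ⊔ y`, hence by distributivity below `m ⊔ n ⊔ (x ⊓ y)`. -/
theorem exists_prime_notMem {c : A} (hc : c ≠ 0) : ∃ P : Set A, IsPrimeSkewIdeal P ∧ c ∉ P := by
  obtain ⟨M, hM⟩ := zorn_subset {I : Set A | IsSkewIdeal I ∧ c ∉ I} (by
    intro C hC hchain
    rcases C.eq_empty_or_nonempty with rfl | ⟨I₀, hI₀⟩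
    -- The empty chain is bounded by the zero ideal, which misses `c` because `c ≠ 0`.
    · refine ⟨{0}, ⟨⟨rfl, ?_, ?_⟩, hc⟩, by simp⟩
      · rintro _ rfl _ rfl
        exact SkewBooleanAlgebra.zero_sup 0
      · rintro x _ h rfl
        rw [natPreLE_iff, zero_inf] at h
        exact h.symm
    · refine ⟨⋃₀ C, ⟨⟨⟨I₀, hI₀, (hC hI₀).1.zero_mem⟩, ?_, ?_⟩, ?_⟩,
        fun s hs => Set.subset_sUnion_of_mem hs⟩
      · rintro x ⟨I, hI, hx⟩ y ⟨J, hJ, hy⟩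
        rcases hchain.total hI hJ with h | h
        · exact ⟨J, hJ, (hC hJ).1.sup_mem _ (h hx) _ hy⟩
        · exact ⟨I, hI, (hC hI).1.sup_mem _ hx _ (h hy)⟩
      · rintro x y h ⟨I, hI, hy⟩
        exact ⟨I, hI, (hC hI).1.lower _ _ h hy⟩
      · rintro ⟨I, hI, h⟩
        exact (hC hI).2 h)
  obtain ⟨⟨hI, hcM⟩, hmax⟩ := hM
  refine ⟨M, ⟨hI, fun h => hcM (h ▸ Set.mem_univ c), fun x y hxy => ?_⟩, hcM⟩
  by_contra! hn
  have key : ∀ x ∉ M, ∃ m ∈ M, NatPreLE c (m ⊔ x) := by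
    intro x hx
    by_contra hcx
    refine hx (hmax ⟨isSkewIdeal_adjoin hI x, hcx⟩ (fun z hz => ⟨z, hz, natPreLE_sup_left z x⟩)
      ⟨0, hI.zero_mem, natPreLE_sup_right 0 x⟩)
  obtain ⟨m, hm, hcm⟩ := key x hn.1
  obtain ⟨n, hn', hcn⟩ := key y hn.2
  refine hcM (hI.lower _ _ (natPreLE_trans (natPreLE_inf hcm hcn) ?_)
    (hI.sup_mem _ (hI.sup_mem _ hm _ hn') _ hxy))
  have hm' : NatPreLE m ((m ⊔ n) ⊔ x ⊓ y) :=
    natPreLE_trans (natPreLE_sup_left m n) (natPreLE_sup_left _ _)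
  have hn'' : NatPreLE n ((m ⊔ n) ⊔ x ⊓ y) :=
    natPreLE_trans (natPreLE_sup_right m n) (natPreLE_sup_left _ _)
  rw [SkewBooleanAlgebra.inf_sup_left, SkewBooleanAlgebra.inf_sup_right, SkewBooleanAlgebra.inf_sup_right]
  exact sup_natPreLE (sup_natPreLE (natPreLE_trans (inf_natPreLE_left _ _) hm')
      (natPreLE_trans (inf_natPreLE_right _ _) hn''))
    (sup_natPreLE (natPreLE_trans (inf_natPreLE_left _ _) hm') (natPreLE_sup_right _ _))

/-- The differences `x \ (x ∩ y)` and `y \ (x ∩ y)` lie in every prime ideal, so they vanish and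
both elements equal `x ∩ y`. -/
theorem eq_of_primeRel {x y : A} (h : ∀ P : Set A, IsPrimeSkewIdeal P → PrimeRel P x y) :
    x = y := by
  have key : ∀ z, NatLE (x ∩ y) z → (∀ P, IsPrimeSkewIdeal P → x ∩ y ∈ P → z ∈ P) →
      z = x ∩ y := by
    intro z hz hzP
    have h0 : z \ (x ∩ y) = 0 := by
      by_contra hne
      obtain ⟨P, hP, hn⟩ := exists_prime_notMem hne
      rw [hP.sdiff_mem_iff] at hn
      push Not at hn
      exact hn.1 (hzP P hP hn.2)
    have h1 := sdiff_sup_inf z (x ∩ y)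
    rw [hz.1, h0, SkewBooleanAlgebra.zero_sup] at h1
    exact h1.symm
  have hx := key x (inter_le_left x y) fun P hP hc => ((h P hP).resolve_right (not_not.2 hc)).1
  have hy := key y (inter_le_right x y) fun P hP hc => ((h P hP).resolve_right (not_not.2 hc)).2
  rw [hx, ← hy]

end SkewAlgebra

/-! ### Boolean spaces -/

namespace IsBooleanSpace

open TopologicalSpace

variable {X : Type u} [TopologicalSpace X]

theorem of_isTopologicalBasis [T2Space X] {s : Set (Set X)} (hs : IsTopologicalBasis s)
    (hc : ∀ U ∈ s, IsCompact U) : IsBooleanSpace X where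
  t2 := inferInstance
  locallyCompact := by
    have : WeaklyLocallyCompactSpace X := ⟨fun x => by
      obtain ⟨U, hU, hx, -⟩ := hs.exists_subset_of_mem_open (Set.mem_univ x) isOpen_univ
      exact ⟨U, hc U hU, (hs.isOpen hU).mem_nhds hx⟩⟩
    infer_instance
  zeroDim := by
    refine isTopologicalBasis_of_isOpen_of_nhds (fun U hU => hU.isOpen) fun x V hx hV => ?_
    obtain ⟨U, hU, hxU, hUV⟩ := hs.exists_subset_of_mem_open hx hV
    exact ⟨U, ⟨(hc U hU).isClosed, hs.isOpen hU⟩, hxU, hUV⟩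

theorem exists_compact_open (hX : IsBooleanSpace X) {x : X} {U : Set X} (hU : IsOpen U)
    (hx : x ∈ U) : ∃ V : Set X, IsCompact V ∧ IsOpen V ∧ x ∈ V ∧ V ⊆ U := by
  have := hX.locallyCompact
  obtain ⟨K, hK, hxK, hKU⟩ := exists_compact_subset hU hx
  obtain ⟨V, hV, hxV, hVK⟩ := hX.zeroDim.exists_subset_of_mem_open hxK isOpen_interior
  exact ⟨V, hK.of_isClosed_subset hV.1 (hVK.trans interior_subset), hV.2, hxV,
    (hVK.trans interior_subset).trans hKU⟩

end IsBooleanSpace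

/-- Properness can be tested on a family of open sets which covers the codomain. -/
theorem IsProperPartialMap.of_cover {X Y : Type u} [TopologicalSpace X] [TopologicalSpace Y]
    [T2Space Y] {f : X →. Y} (hf : PContinuous f) {ι : Type*} (U : ι → Set Y)
    (hU : ∀ i, IsOpen (U i)) (hcover : ∀ y, ∃ i, y ∈ U i)
    (hc : ∀ i, IsCompact (f.preimage (U i))) : IsProperPartialMap f := by
  refine ⟨hf, fun K hK => ?_⟩
  obtain ⟨t, ht⟩ := hK.elim_finite_subcover U hU fun y _ => Set.mem_iUnion.2 (hcover y)
  -- The compact set `K` is closed in a Hausdorff space, so its inverse image is a finite union of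
  -- compact sets minus an open set.
  have h : f.preimage K = (⋃ i ∈ t, f.preimage (U i)) \ f.preimage Kᶜ := by
    ext x
    simp only [PFun.mem_preimage, Set.mem_sdiff, Set.mem_iUnion, exists_prop]
    constructor
    · rintro ⟨y, hy, hyx⟩
      obtain ⟨i, hi, hyi⟩ := Set.mem_iUnion₂.1 (ht hy)
      refine ⟨⟨i, hi, y, hyi, hyx⟩, ?_⟩
      rintro ⟨z, hz, hzx⟩
      exact hz (Part.mem_unique hyx hzx ▸ hy)
    · rintro ⟨⟨i, hi, y, hyi, hyx⟩, hn⟩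
      exact ⟨y, not_not.1 fun hy => hn ⟨y, hy, hyx⟩, hyx⟩
  rw [h]
  exact (t.isCompact_biUnion fun i _ => hc i).diff (hf _ hK.isClosed.isOpen_compl)

theorem PContinuous.of_isTopologicalBasis {X Y : Type u} [TopologicalSpace X] [TopologicalSpace Y]
    {f : X →. Y} {s : Set (Set Y)} (hs : TopologicalSpace.IsTopologicalBasis s)
    (h : ∀ U ∈ s, IsOpen (f.preimage U)) : PContinuous f := by
  intro V hV
  rw [isOpen_iff_forall_mem_open]
  rintro x ⟨y, hy, hyx⟩
  obtain ⟨U, hU, hyU, hUV⟩ := hs.exists_subset_of_mem_open hy hV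
  exact ⟨f.preimage U, f.preimage_mono hUV, h U hU, y, hyU, hyx⟩

/-! ### The spectrum -/

namespace St

variable {A : Type u} [SkewAlgebra A]

theorem mem_basic {P : St A} {a : A} : P ∈ St.basic a ↔ a ∉ P.ideal := Iff.rfl

theorem isOpen_basic (a : A) : IsOpen (St.basic a) :=
  TopologicalSpace.isOpen_generateFrom_of_mem ⟨a, rfl⟩

theorem exists_notMem (P : St A) : ∃ a, a ∉ P.ideal := by
  by_contra! h
  exact P.isPrime.ne_univ (Set.eq_univ_of_forall h)

variable [RightHanded A]

theorem isTopologicalBasis : TopologicalSpace.IsTopologicalBasis (Set.range (St.basic (A := A))) where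
  exists_subset_inter := by
    rintro _ ⟨a, rfl⟩ _ ⟨b, rfl⟩ P ⟨ha, hb⟩
    refine ⟨_, ⟨a ⊓ b, rfl⟩, ?_, fun Q hQ => ?_⟩
    · exact mt P.isPrime.inf_mem_iff.1 (not_or.2 ⟨ha, hb⟩)
    · exact not_or.1 (mt Q.isPrime.inf_mem_iff.2 hQ)
  sUnion_eq := Set.eq_univ_of_forall fun P =>
    let ⟨a, ha⟩ := P.exists_notMem
    ⟨_, ⟨a, rfl⟩, ha⟩
  eq_generateFrom := rfl

/-- An ultrafilter `U` containing `N_a` converges to the ideal of those `b` with `N_b ∉ U`. The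
ultrafilter axioms make it prime, and `a` witnesses that it is proper. -/
theorem isCompact_basic (a : A) : IsCompact (St.basic a) := by
  rw [isCompact_iff_ultrafilter_le_nhds']
  intro U ha
  have hcompl : ∀ {s : Set (St A)}, s ∉ U ↔ sᶜ ∈ U := Ultrafilter.compl_mem_iff_notMem.symm
  have hmono : ∀ b c : A, NatPreLE b c → St.basic b ⊆ St.basic c := fun b c hbc Q hQ hc =>
    hQ (Q.isPrime.isIdeal.lower _ _ hbc hc)
  let P : St A :=
    { ideal := {b | St.basic b ∉ U}
      isPrime :=
        { isIdeal :=
            { zero_mem := by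
                have h : St.basic (0 : A) = ∅ :=
                  Set.eq_empty_of_forall_notMem fun Q hQ => hQ Q.isPrime.isIdeal.zero_mem
                rw [Set.mem_ofPred_eq, h]
                exact Ultrafilter.empty_notMem
              sup_mem := fun x hx y hy h => by
                have h' : St.basic (x ⊔ y) ⊆ St.basic x ∪ St.basic y := fun Q hQ =>
                  not_and_or.1 (mt Q.isPrime.sup_mem_iff.2 hQ)
                exact (Ultrafilter.union_mem_iff.1 (Filter.mem_of_superset h h')).elim hx hy
              lower := fun x y hxy hy hx => hy (Filter.mem_of_superset hx (hmono x y hxy)) }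
          ne_univ := fun h => (h ▸ Set.mem_univ a : a ∈ {b | St.basic b ∉ U}) ha
          prime := fun x y h => by
            by_contra! hn
            simp only [Set.mem_ofPred_eq, not_not] at hn
            refine h (Filter.mem_of_superset (Filter.inter_mem hn.1 hn.2) fun Q hQ => ?_)
            exact mt Q.isPrime.inf_mem_iff.1 (not_or.2 hQ) } }
  refine ⟨P, not_not.2 ha, ?_⟩
  rw [TopologicalSpace.nhds_generateFrom]
  simp only [le_iInf_iff, Filter.le_principal_iff]
  rintro _ ⟨hb, b, rfl⟩
  exact not_not.1 hb

instance : T2Space (St A) := by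
  have key : ∀ P Q : St A, ∀ a ∈ Q.ideal, a ∉ P.ideal →
      ∃ u v : Set (St A), IsOpen u ∧ IsOpen v ∧ P ∈ u ∧ Q ∈ v ∧ Disjoint u v := by
    intro P Q a haQ haP
    obtain ⟨b, hb⟩ := Q.exists_notMem
    -- With `b ∉ Q` and `a ∈ Q`, the sets `N_a` and `N_{b \ a}` are disjoint and contain `P` and
    -- `Q`.
    refine ⟨_, _, isOpen_basic a, isOpen_basic (b \ a), haP, ?_, ?_⟩
    · rw [mem_basic, Q.isPrime.sdiff_mem_iff]; tauto
    · refine Set.disjoint_left.2 fun R hR hR' => ?_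
      rw [mem_basic, R.isPrime.sdiff_mem_iff] at hR'
      exact hR' (Or.inr hR)
  refine ⟨fun P Q hPQ => ?_⟩
  by_cases h : Q.ideal ⊆ P.ideal
  · have h' : ¬ P.ideal ⊆ Q.ideal := fun h' => hPQ (St.ext (h'.antisymm h))
    obtain ⟨a, ha, ha'⟩ := Set.not_subset.1 h'
    obtain ⟨u, v, hu, hv, hQu, hPv, huv⟩ := key Q P a ha ha'
    exact ⟨v, u, hv, hu, hPv, hQu, huv.symm⟩
  · obtain ⟨a, ha, ha'⟩ := Set.not_subset.1 h
    exact key P Q a ha ha'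

theorem isBooleanSpace : IsBooleanSpace (St A) :=
  IsBooleanSpace.of_isTopologicalBasis isTopologicalBasis (by
    rintro _ ⟨a, rfl⟩
    exact isCompact_basic a)

end St

/-! ### The skew spectrum -/

namespace Sk

variable {A : Type u} [SkewAlgebra A]

theorem exists_eq_mkPoint (x : Sk A) : ∃ t, ∃ h : t ∉ x.prime.ideal, x = mkPoint x.prime t h := by
  obtain ⟨P, c, t, ht, rfl⟩ := x
  exact ⟨t, ht, rfl⟩

theorem isOpen_basic (a : A) : IsOpen (Sk.basic a) :=
  TopologicalSpace.isOpen_generateFrom_of_mem ⟨a, rfl⟩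

theorem mkPoint_mem_basic (P : St A) (t : A) (ht : t ∉ P.ideal) : mkPoint P t ht ∈ Sk.basic t :=
  ⟨P, ht, rfl⟩

theorem exists_mem_basic (x : Sk A) : ∃ a, x ∈ Sk.basic a :=
  let ⟨t, ht, h⟩ := x.exists_eq_mkPoint
  ⟨t, _, ht, h⟩

theorem prime_surjective : Function.Surjective (prime : Sk A → St A) := fun P =>
  let ⟨a, ha⟩ := P.exists_notMem
  ⟨mkPoint P a ha, rfl⟩

theorem notMem_of_mem_basic {x : Sk A} {a : A} (h : x ∈ Sk.basic a) : a ∉ x.prime.ideal := by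
  obtain ⟨P, ha, rfl⟩ := h
  exact ha

theorem eq_mkPoint_of_mem_basic {x : Sk A} {a : A} (h : x ∈ Sk.basic a) :
    x = mkPoint x.prime a (notMem_of_mem_basic h) := by
  obtain ⟨P, ha, rfl⟩ := h
  rfl

theorem injOn_basic (a : A) : Set.InjOn prime (Sk.basic a) := by
  rintro _ ⟨P, ha, rfl⟩ _ ⟨Q, hb, rfl⟩ h
  obtain rfl : P = Q := h
  rfl

theorem image_basic (a : A) : prime '' Sk.basic a = St.basic a := by
  ext P
  constructor
  · rintro ⟨_, ⟨Q, ha, rfl⟩, rfl⟩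
    exact ha
  · exact fun ha => ⟨mkPoint P a ha, mkPoint_mem_basic P a ha, rfl⟩

theorem mem_basic_zero (x : Sk A) : x ∈ Sk.basic (0 : A) ↔ False :=
  iff_of_false (fun h => notMem_of_mem_basic h x.prime.isPrime.isIdeal.zero_mem) not_false

variable [RightHanded A]

theorem mkPoint_eq_iff {P Q : St A} {s t : A} (hs : s ∉ P.ideal) (ht : t ∉ Q.ideal) :
    mkPoint P s hs = mkPoint Q t ht ↔ P = Q ∧ PrimeRel P.ideal s t := by
  constructor
  · intro h
    obtain rfl : P = Q := congrArg prime h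
    refine ⟨rfl, ?_⟩
    rw [← SkewAlgebra.theta_iff P.isPrime]
    simp only [mkPoint, mk.injEq, heq_eq_eq, true_and] at h
    exact Quotient.exact h
  · rintro ⟨rfl, h⟩
    rw [← SkewAlgebra.theta_iff P.isPrime] at h
    simp only [mkPoint, mk.injEq, heq_eq_eq, true_and]
    exact Quotient.sound h

theorem mkPoint_mem_basic_iff {P : St A} {t a : A} (ht : t ∉ P.ideal) :
    mkPoint P t ht ∈ Sk.basic a ↔ PrimeRel P.ideal a t := by
  constructor
  · rintro ⟨Q, ha, h⟩
    rw [mkPoint_eq_iff] at h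
    exact h.2.symm P.isPrime
  · intro h
    have ha : a ∉ P.ideal := mt (h.mem_iff P.isPrime).1 ht
    exact ⟨P, ha, (mkPoint_eq_iff _ _).2 ⟨rfl, h.symm P.isPrime⟩⟩

theorem mkPoint_mem_basic_congr {P : St A} {t a b : A} (ht : t ∉ P.ideal)
    (h : PrimeRel P.ideal a b) : mkPoint P t ht ∈ Sk.basic a ↔ mkPoint P t ht ∈ Sk.basic b := by
  rw [mkPoint_mem_basic_iff, mkPoint_mem_basic_iff]
  exact ⟨(h.symm P.isPrime).trans P.isPrime, h.trans P.isPrime⟩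

/-- Membership in `M_a` depends only on the class of `a` at the prime of `x`. Combined with the
projection rules, this computes `M` of a meet, join or difference. -/
theorem mem_basic_congr {x : Sk A} {a b : A} (h : PrimeRel x.prime.ideal a b) :
    x ∈ Sk.basic a ↔ x ∈ Sk.basic b := by
  obtain ⟨t, ht, hx⟩ := x.exists_eq_mkPoint
  rw [hx]
  exact mkPoint_mem_basic_congr ht h

theorem mem_basic_inf (x : Sk A) (a b : A) :
    x ∈ Sk.basic (a ⊓ b) ↔ a ∉ x.prime.ideal ∧ x ∈ Sk.basic b := by
  by_cases ha : a ∈ x.prime.ideal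
  · refine iff_of_false (fun h => notMem_of_mem_basic h ?_) fun h => h.1 ha
    exact x.prime.isPrime.inf_mem_iff.2 (Or.inl ha)
  · rw [mem_basic_congr (PrimeRel.inf_of_notMem x.prime.isPrime ha)]
    tauto

theorem mem_basic_sup (x : Sk A) (a b : A) :
    x ∈ Sk.basic (a ⊔ b) ↔ x ∈ Sk.basic a ∨ (x ∈ Sk.basic b ∧ a ∈ x.prime.ideal) := by
  by_cases ha : a ∈ x.prime.ideal
  · rw [mem_basic_congr (PrimeRel.sup_of_mem x.prime.isPrime ha)]
    have := fun h : x ∈ Sk.basic a => notMem_of_mem_basic h ha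
    tauto
  · rw [mem_basic_congr (PrimeRel.sup_of_notMem x.prime.isPrime ha)]
    tauto

theorem mem_basic_sdiff (x : Sk A) (a b : A) :
    x ∈ Sk.basic (a \ b) ↔ x ∈ Sk.basic a ∧ b ∈ x.prime.ideal := by
  by_cases hb : b ∈ x.prime.ideal
  · rw [mem_basic_congr (PrimeRel.sdiff_of_mem x.prime.isPrime hb)]
    tauto
  · refine iff_of_false (fun h => notMem_of_mem_basic h ?_) fun h => hb h.2
    exact x.prime.isPrime.sdiff_mem_iff.2 (Or.inr hb)

theorem mem_basic_inter (x : Sk A) (a b : A) :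
    x ∈ Sk.basic (a ∩ b) ↔ x ∈ Sk.basic a ∧ x ∈ Sk.basic b := by
  obtain ⟨t, ht, hx⟩ := x.exists_eq_mkPoint
  have hP := x.prime.isPrime
  constructor
  · intro h
    have hc := notMem_of_mem_basic h
    have hle : NatLE (a ∩ b) (a ∩ b) := ⟨SkewLattice.inf_idem _, SkewLattice.inf_idem _⟩
    exact ⟨(mem_basic_congr (PrimeRel.of_natLE hP hc hle (SkewAlgebra.inter_le_left a b))).1 h,
      (mem_basic_congr (PrimeRel.of_natLE hP hc hle (SkewAlgebra.inter_le_right a b))).1 h⟩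
  · rintro ⟨ha, hb⟩
    rw [hx, mkPoint_mem_basic_iff] at ha hb
    have h := ha.trans hP (hb.symm hP)
    rw [hx, mkPoint_mem_basic_iff]
    exact (h.inter_left hP).trans hP ha

theorem isTopologicalBasis : TopologicalSpace.IsTopologicalBasis (Set.range (Sk.basic (A := A))) where
  exists_subset_inter := by
    rintro _ ⟨a, rfl⟩ _ ⟨b, rfl⟩ x hx
    exact ⟨_, ⟨a ∩ b, rfl⟩, (mem_basic_inter x a b).2 hx, fun y hy => (mem_basic_inter y a b).1 hy⟩
  sUnion_eq := Set.eq_univ_of_forall fun x =>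
    let ⟨a, ha⟩ := x.exists_mem_basic
    ⟨_, ⟨a, rfl⟩, ha⟩
  eq_generateFrom := rfl

theorem continuous_prime : Continuous (prime : Sk A → St A) := by
  rw [St.isTopologicalBasis.continuous_iff]
  rintro _ ⟨a, rfl⟩
  rw [isOpen_iff_forall_mem_open]
  intro x hx
  obtain ⟨b, hb⟩ := x.exists_mem_basic
  -- The set `M_{a ⊓ b}` is the part of `M_b` lying over `N_a`.
  exact ⟨Sk.basic (a ⊓ b), fun y hy => ((mem_basic_inf y a b).1 hy).1, isOpen_basic _,
    (mem_basic_inf x a b).2 ⟨hx, hb⟩⟩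

theorem isOpenMap_prime : IsOpenMap (prime : Sk A → St A) := by
  rw [isTopologicalBasis.isOpenMap_iff]
  rintro _ ⟨a, rfl⟩
  rw [image_basic]
  exact St.isOpen_basic a

theorem isOpenEmbedding_restrict (a : A) :
    Topology.IsOpenEmbedding ((Sk.basic a).domRestrict (prime : Sk A → St A)) :=
  .of_continuous_injective_isOpenMap (continuous_prime.comp continuous_subtype_val)
    (Set.injOn_iff_injective.1 (injOn_basic a)) (isOpenMap_prime.domRestrict (isOpen_basic a))

theorem isLocalHomeomorph_prime : IsLocalHomeomorph (prime : Sk A → St A) := by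
  rw [isLocalHomeomorph_iff_isOpenEmbedding_restrict]
  intro x
  obtain ⟨a, ha⟩ := x.exists_mem_basic
  exact ⟨_, (isOpen_basic a).mem_nhds ha, isOpenEmbedding_restrict a⟩

/-- Compactness of `N_a` is transported along the open embedding of `M_a` onto it. -/
theorem isCompact_basic (a : A) : IsCompact (Sk.basic a) := by
  rw [isCompact_iff_isCompact_univ, (isOpenEmbedding_restrict a).isInducing.isCompact_iff,
    Set.image_univ, Set.range_domRestrict, image_basic]
  exact St.isCompact_basic a

instance : T2Space (Sk A) := by
  refine ⟨fun x y hxy => ?_⟩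
  by_cases h : x.prime = y.prime
  · obtain ⟨a, ha⟩ := x.exists_mem_basic
    obtain ⟨b, hb⟩ := y.exists_mem_basic
    have hy : y ∉ Sk.basic a := fun hy => hxy (injOn_basic a ha hy h)
    -- In a common fiber, `a ∩ b ∉ P` would give a point of both `M_a` and `M_b`, forcing `x = y`.
    -- Hence removing `a ∩ b` keeps both points and makes the two neighbourhoods disjoint.
    have hc : a ∩ b ∈ x.prime.ideal := by
      by_contra hc
      have hxc : mkPoint x.prime (a ∩ b) hc ∈ Sk.basic (a ∩ b) := mkPoint_mem_basic _ _ _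
      rw [mem_basic_inter] at hxc
      exact hy (injOn_basic b hxc.2 hb h ▸ hxc.1)
    refine ⟨_, _, isOpen_basic (a \ (a ∩ b)), isOpen_basic (b \ (a ∩ b)),
      (mem_basic_sdiff x _ _).2 ⟨ha, hc⟩, (mem_basic_sdiff y _ _).2 ⟨hb, h ▸ hc⟩,
      Set.disjoint_left.2 fun z hz hz' => ?_⟩
    rw [mem_basic_sdiff] at hz hz'
    exact notMem_of_mem_basic ((mem_basic_inter z a b).2 ⟨hz.1, hz'.1⟩) hz.2
  · obtain ⟨u, v, hu, hv, hxu, hyv, huv⟩ := t2_separation h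
    exact ⟨_, _, hu.preimage continuous_prime, hv.preimage continuous_prime, hxu, hyv,
      huv.preimage _⟩

theorem isSkewBooleanSpace : IsSkewBooleanSpace (prime : Sk A → St A) where
  total := IsBooleanSpace.of_isTopologicalBasis isTopologicalBasis (by
    rintro _ ⟨a, rfl⟩
    exact isCompact_basic a)
  base := St.isBooleanSpace
  etale := isLocalHomeomorph_prime
  surjective := prime_surjective

end Sk

/-! ### Functoriality of the skew spectrum -/

namespace SkewHom

variable {A A' : Type u} [SkewAlgebra A] [SkewAlgebra A']

theorem mem_down_iff (f : SkewHom A A') {P : St A'} {Q : St A} :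
    Q ∈ f.down P ↔ Q.ideal = f.toFun ⁻¹' P.ideal := by
  constructor
  · rintro ⟨h, rfl⟩
    rfl
  · intro h
    exact ⟨fun h' => Q.isPrime.ne_univ (h.trans h'), St.ext h.symm⟩

/-- This is where preservation of `∩` matters: it makes `f^↑` independent of the representative. -/
theorem primeRel_map_iff (f : SkewHom A A') {P : St A'} {a b : A} :
    PrimeRel P.ideal (f.toFun a) (f.toFun b) ↔ PrimeRel (f.toFun ⁻¹' P.ideal) a b := by
  rw [PrimeRel, PrimeRel, ← f.map_inter]
  rfl

theorem down_preimage_basic (f : SkewHom A A') (a : A) :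
    f.down.preimage (St.basic a) = St.basic (f.toFun a) := by
  ext P
  rw [PFun.mem_preimage]
  constructor
  · rintro ⟨Q, hQ, hQP⟩
    rw [mem_down_iff] at hQP
    rw [St.mem_basic, hQP] at hQ
    exact hQ
  · intro ha
    exact ⟨⟨f.toFun ⁻¹' P.ideal, P.isPrime.preimage f (f.preimage_ne_univ ha)⟩, ha,
      f.mem_down_iff.2 rfl⟩

variable [RightHanded A] [RightHanded A']

/-- The choice of representative in `SkewHom.up` is replaced by a relation that any representative
can witness. -/
theorem mem_up_iff (f : SkewHom A A') {x : Sk A'} {y : Sk A} :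
    y ∈ f.up x ↔ y.prime.ideal = f.toFun ⁻¹' x.prime.ideal ∧
      ∃ a, y ∈ Sk.basic a ∧ x ∈ Sk.basic (f.toFun a) := by
  constructor
  · rintro ⟨h, rfl⟩
    refine ⟨rfl, h.choose, Sk.mkPoint_mem_basic ⟨f.toFun ⁻¹' x.prime.ideal,
      x.prime.isPrime.preimage f (f.preimage_ne_univ h.choose_spec.choose)⟩ h.choose
      h.choose_spec.choose, ?_⟩
    exact ⟨_, h.choose_spec.choose, h.choose_spec.choose_spec⟩
  · rintro ⟨hP, a, hy, hx⟩
    have hx' := Sk.eq_mkPoint_of_mem_basic hx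
    have hd : ∃ a : A, ∃ h : f.toFun a ∉ x.prime.ideal, x = Sk.mkPoint x.prime (f.toFun a) h :=
      ⟨a, _, hx'⟩
    refine ⟨hd, ?_⟩
    rw [Sk.eq_mkPoint_of_mem_basic hy]
    refine (Sk.mkPoint_eq_iff (P := ⟨f.toFun ⁻¹' x.prime.ideal, x.prime.isPrime.preimage f
      (f.preimage_ne_univ hd.choose_spec.choose)⟩) hd.choose_spec.choose _).2 ⟨St.ext hP.symm, ?_⟩
    refine f.primeRel_map_iff.1 ?_
    have h := hd.choose_spec.choose_spec.symm.trans hx'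
    exact ((Sk.mkPoint_eq_iff _ _).1 h).2

theorem mem_basic_iff_of_mem_up (f : SkewHom A A') {x : Sk A'} {y : Sk A} (h : y ∈ f.up x) (a : A) :
    x ∈ Sk.basic (f.toFun a) ↔ y ∈ Sk.basic a := by
  obtain ⟨hP, b, hy, hx⟩ := f.mem_up_iff.1 h
  rw [Sk.eq_mkPoint_of_mem_basic hx, Sk.eq_mkPoint_of_mem_basic hy, Sk.mkPoint_mem_basic_iff,
    Sk.mkPoint_mem_basic_iff, f.primeRel_map_iff, hP]

theorem exists_mem_up (f : SkewHom A A') {x : Sk A'} {a : A} (h : x ∈ Sk.basic (f.toFun a)) :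
    ∃ y ∈ Sk.basic a, y ∈ f.up x := by
  have ha := Sk.notMem_of_mem_basic h
  let P : St A := ⟨f.toFun ⁻¹' x.prime.ideal, x.prime.isPrime.preimage f (f.preimage_ne_univ ha)⟩
  exact ⟨Sk.mkPoint P a ha, Sk.mkPoint_mem_basic _ _ _,
    f.mem_up_iff.2 ⟨rfl, a, Sk.mkPoint_mem_basic _ _ _, h⟩⟩

theorem up_preimage_basic (f : SkewHom A A') (a : A) :
    f.up.preimage (Sk.basic a) = Sk.basic (f.toFun a) := by
  ext x
  rw [PFun.mem_preimage]
  constructor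
  · rintro ⟨y, hy, hyx⟩
    exact (f.mem_basic_iff_of_mem_up hyx a).2 hy
  · exact f.exists_mem_up

theorem isSkewMorphism (f : SkewHom A A') :
    IsSkewMorphism (Sk.prime : Sk A' → St A') (Sk.prime : Sk A → St A) f.up f.down where
  top := by
    refine .of_cover (.of_isTopologicalBasis Sk.isTopologicalBasis ?_) Sk.basic Sk.isOpen_basic
      Sk.exists_mem_basic fun a => ?_
    · rintro _ ⟨a, rfl⟩
      rw [up_preimage_basic]
      exact Sk.isOpen_basic _
    · rw [up_preimage_basic]
      exact Sk.isCompact_basic _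
  bot := by
    refine .of_cover (.of_isTopologicalBasis St.isTopologicalBasis ?_) St.basic St.isOpen_basic
      St.exists_notMem fun a => ?_
    · rintro _ ⟨a, rfl⟩
      rw [down_preimage_basic]
      exact St.isOpen_basic _
    · rw [down_preimage_basic]
      exact St.isCompact_basic _
  comm x y h := f.mem_down_iff.2 (f.mem_up_iff.1 h).1
  bijOnFibers := by
    rintro P _ hP y rfl
    rw [mem_down_iff] at hP
    obtain ⟨a, ha⟩ := y.exists_mem_basic
    have hfa : f.toFun a ∉ P.ideal := by
      have h := Sk.notMem_of_mem_basic ha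
      rwa [hP] at h
    -- If `a` represents `y`, the point over `P` must be `P_{f a}`: any preimage of `y` lies in
    -- `M_{f a}`, which has a single point in the fiber.
    refine ⟨Sk.mkPoint P (f.toFun a) hfa,
      ⟨rfl, f.mem_up_iff.2 ⟨hP, a, ha, Sk.mkPoint_mem_basic _ _ _⟩⟩, ?_⟩
    rintro x ⟨rfl, hx⟩
    exact Sk.eq_mkPoint_of_mem_basic ((f.mem_basic_iff_of_mem_up hx a).2 ha)

end SkewHom

theorem spectrumWellDefined : SpectrumWellDefined.{u} where
  isSkew A := Sk.isSkewBooleanSpace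
  up_mkPoint f P a h :=
    f.mem_up_iff.2 ⟨rfl, a, Sk.mkPoint_mem_basic _ _ _, Sk.mkPoint_mem_basic _ _ _⟩
  isMorphism f := f.isSkewMorphism
  up_id A := PFun.ext fun x y => by
    rw [SkewHom.mem_up_iff, PFun.id_apply, Part.mem_some_iff]
    constructor
    · rintro ⟨h, a, hy, hx⟩
      exact Sk.injOn_basic a hy hx (St.ext h)
    · rintro rfl
      obtain ⟨a, ha⟩ := y.exists_mem_basic
      exact ⟨rfl, a, ha, ha⟩
  down_id A := PFun.ext fun P Q => by
    rw [SkewHom.mem_down_iff, PFun.id_apply, Part.mem_some_iff]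
    exact ⟨fun h => St.ext h, fun h => h ▸ rfl⟩
  up_comp f g := PFun.ext fun x z => by
    rw [PFun.mem_comp_iff, SkewHom.mem_up_iff]
    constructor
    · rintro ⟨h, a, hz, hx⟩
      obtain ⟨y, hy, hyx⟩ := g.exists_mem_up hx
      refine ⟨y, hyx, f.mem_up_iff.2 ⟨?_, a, hz, hy⟩⟩
      rw [h, (g.mem_up_iff.1 hyx).1]
      rfl
    · rintro ⟨y, hyx, hzy⟩
      obtain ⟨h, a, hz, hy⟩ := f.mem_up_iff.1 hzy
      refine ⟨?_, a, hz, (g.mem_basic_iff_of_mem_up hyx _).2 hy⟩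
      rw [h, (g.mem_up_iff.1 hyx).1]
      rfl
  down_comp f g := PFun.ext fun P R => by
    rw [PFun.mem_comp_iff, SkewHom.mem_down_iff]
    constructor
    · intro h
      -- If pulling back along `g` already gave everything, so would the composite, contradicting
      -- properness of `R`.
      have hn : g.toFun ⁻¹' P.ideal ≠ Set.univ := by
        intro h'
        refine R.isPrime.ne_univ (h.trans (Set.eq_univ_of_forall fun a => ?_))
        exact (h' ▸ Set.mem_univ (f.toFun a) : f.toFun a ∈ g.toFun ⁻¹' P.ideal)
      exact ⟨⟨_, P.isPrime.preimage g hn⟩, g.mem_down_iff.2 rfl, f.mem_down_iff.2 h⟩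
    · rintro ⟨Q, hQ, hR⟩
      rw [SkewHom.mem_down_iff] at hQ hR
      rw [hR, hQ]
      rfl

/-! ### Isomorphisms of skew Boolean spaces -/

theorem IsProperPartialMap.of_homeomorph {X Y : Type u} [TopologicalSpace X] [TopologicalSpace Y]
    (f : X ≃ₜ Y) : IsProperPartialMap (PFun.lift f) :=
  ⟨fun s hs => by rw [PFun.coe_preimage]; exact hs.preimage f.continuous,
    fun K hK => by rw [PFun.coe_preimage]; exact f.isCompact_preimage.2 hK⟩

namespace SkewBooleanSpace

theorem mem_lift_iff {X Y : Type u} (f : X → Y) (x : X) (y : Y) : y ∈ PFun.lift f x ↔ y = f x :=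
  Part.mem_some_iff

/-- The morphism given by a pair of compatible homeomorphisms. -/
def homOfHomeomorph {X Y : SkewBooleanSpace.{u}} (g : X.E ≃ₜ Y.E) (h : X.B ≃ₜ Y.B)
    (comm : ∀ e, Y.p (g e) = h (X.p e)) : Hom X Y where
  g := PFun.lift g
  h := PFun.lift h
  isMorphism :=
    { top := .of_homeomorph g
      bot := .of_homeomorph h
      comm := fun e e' he => by
        rw [mem_lift_iff] at he ⊢
        rw [he, comm]
      bijOnFibers := fun b b' hb e' he' => by
        rw [mem_lift_iff] at hb
        refine ⟨g.symm e', ⟨h.injective ?_, ?_⟩, ?_⟩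
        · rw [← comm, g.apply_symm_apply, he', hb]
        · rw [mem_lift_iff, g.apply_symm_apply]
        · rintro e ⟨-, he⟩
          rw [mem_lift_iff] at he
          rw [he, g.symm_apply_apply] }

/-- Compatible homeomorphisms of total spaces and of bases give an isomorphism. -/
def isoOfHomeomorph {X Y : SkewBooleanSpace.{u}} (g : X.E ≃ₜ Y.E) (h : X.B ≃ₜ Y.B)
    (comm : ∀ e, Y.p (g e) = h (X.p e)) : X ≅ Y where
  hom := homOfHomeomorph g h comm
  inv := homOfHomeomorph g.symm h.symm fun e => h.injective (by
    rw [← comm, g.apply_symm_apply, h.apply_symm_apply])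
  hom_inv_id := by
    refine Hom.ext ?_ ?_
    · change (PFun.lift g.symm).comp (PFun.lift g) = PFun.id _
      rw [← PFun.coe_comp, g.symm_comp_self, PFun.coe_id]
    · change (PFun.lift h.symm).comp (PFun.lift h) = PFun.id _
      rw [← PFun.coe_comp, h.symm_comp_self, PFun.coe_id]
  inv_hom_id := by
    refine Hom.ext ?_ ?_
    · change (PFun.lift g).comp (PFun.lift g.symm) = PFun.id _
      rw [← PFun.coe_comp, g.self_comp_symm, PFun.coe_id]
    · change (PFun.lift h).comp (PFun.lift h.symm) = PFun.id _
      rw [← PFun.coe_comp, h.self_comp_symm, PFun.coe_id]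

/-! ### The points of a skew Boolean space as points of a skew spectrum -/

section Points

variable {X : SkewBooleanSpace.{u}}

/-- Local injectivity of `p` and the compact open base of `E` show that copen sections form a base.
-/
theorem exists_copenSection {e : X.E} {U : Set X.E} (hU : IsOpen U) (he : e ∈ U) :
    ∃ S : CopenSection X, e ∈ S.carrier ∧ S.carrier ⊆ U := by
  obtain ⟨W, hW, hinj⟩ := X.isSkew.etale.isLocallyInjective e
  obtain ⟨V, hVc, hVo, heV, hVU⟩ := X.isSkew.total.exists_compact_open
    (hU.inter hW) ⟨he, hinj.1⟩
  exact ⟨⟨V, hVc, hVo, hinj.2.mono fun x hx => (hVU hx).2⟩, heV, fun x hx => (hVU hx).1⟩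

theorem exists_mem_copenSection (e : X.E) : ∃ S : CopenSection X, e ∈ S.carrier :=
  let ⟨S, hS, _⟩ := exists_copenSection isOpen_univ (Set.mem_univ e)
  ⟨S, hS⟩

theorem exists_mem_image_copenSection (b : X.B) : ∃ S : CopenSection X, b ∈ X.p '' S.carrier := by
  obtain ⟨e, rfl⟩ := X.isSkew.surjective b
  obtain ⟨S, hS⟩ := exists_mem_copenSection e
  exact ⟨S, e, hS, rfl⟩

/-- The prime ideal of copen sections which do not meet the fiber over `b`. -/
def primeAt (b : X.B) : St (CopenSection X) where
  ideal := {S | b ∉ X.p '' S.carrier}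
  isPrime :=
    { isIdeal :=
        { zero_mem := fun h => (CopenSection.img_zero b).1 h
          sup_mem := fun S hS R hR h => ((CopenSection.img_sup S R b).1 h).elim hS hR
          lower := fun S R h hR hS => by
            rw [SkewAlgebra.natPreLE_iff] at h
            rw [← h, CopenSection.img_inf] at hS
            exact hR hS.1 }
      ne_univ := fun h => by
        obtain ⟨S, hS⟩ := exists_mem_image_copenSection b
        exact (h ▸ Set.mem_univ S : S ∈ {S : CopenSection X | b ∉ X.p '' S.carrier}) hS
      prime := fun S R h => by
        by_contra! hn
        exact h ((CopenSection.img_inf S R b).2 ⟨not_not.1 hn.1, not_not.1 hn.2⟩) }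

theorem notMem_primeAt {b : X.B} {S : CopenSection X} :
    S ∉ (primeAt b).ideal ↔ b ∈ X.p '' S.carrier := not_not

/-- The class of a section modulo the prime of a base point records its value in that fiber. -/
theorem primeRel_primeAt_iff {e : X.E} {S T : CopenSection X} (hT : e ∈ T.carrier) :
    PrimeRel (primeAt (X.p e)).ideal S T ↔ e ∈ S.carrier := by
  constructor
  · rintro (⟨-, h⟩ | h)
    · exact absurd ⟨e, hT, rfl⟩ h
    · rw [notMem_primeAt] at h
      obtain ⟨e', he', h⟩ := h
      exact T.injOn he'.2 hT h ▸ he'.1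
  · intro hS
    exact Or.inr (notMem_primeAt.2 ⟨e, ⟨hS, hT⟩, rfl⟩)

/-- The point of the skew spectrum given by a point of the total space. -/
noncomputable def pointAt (e : X.E) : Sk (CopenSection X) :=
  Sk.mkPoint (primeAt (X.p e)) (exists_mem_copenSection e).choose
    (notMem_primeAt.2 ⟨e, (exists_mem_copenSection e).choose_spec, rfl⟩)

theorem pointAt_mem_basic {e : X.E} {S : CopenSection X} :
    pointAt e ∈ Sk.basic S ↔ e ∈ S.carrier := by
  rw [pointAt, Sk.mkPoint_mem_basic_iff]
  exact primeRel_primeAt_iff (exists_mem_copenSection e).choose_spec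

/-- The images of the sections outside `P` are nonempty, compact, closed and directed downwards
under meets; a point common to all of them represents `P`. -/
theorem exists_primeAt_eq (P : St (CopenSection X)) : ∃ b, primeAt b = P := by
  have hP := P.isPrime
  have := X.isSkew.base.t2
  have hc : ∀ S : CopenSection X, IsCompact (X.p '' S.carrier) := fun S =>
    S.isCompact.image X.isSkew.etale.continuous
  obtain ⟨S₀, hS₀⟩ := P.exists_notMem
  have : Nonempty {S // S ∉ P.ideal} := ⟨⟨S₀, hS₀⟩⟩
  have hne : (⋂ S : {S // S ∉ P.ideal}, X.p '' S.1.carrier).Nonempty := by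
    refine IsCompact.nonempty_iInter_of_directed_nonempty_isCompact_isClosed _ ?_ ?_
      (fun S => hc S.1) fun S => (hc S.1).isClosed
    · intro S R
      refine ⟨⟨S.1 ⊓ R.1, fun h => (hP.prime _ _ h).elim S.2 R.2⟩, ?_, ?_⟩
      · exact fun b hb => ((CopenSection.img_inf _ _ b).1 hb).1
      · exact fun b hb => ((CopenSection.img_inf _ _ b).1 hb).2
    · rintro ⟨S, hS⟩
      refine Set.Nonempty.image _ (Set.nonempty_iff_ne_empty.2 fun h => hS ?_)
      have h0 : S = 0 := CopenSection.ext h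
      exact h0 ▸ hP.isIdeal.zero_mem
  obtain ⟨b, hb⟩ := hne
  have hb : ∀ S, S ∉ P.ideal → b ∈ X.p '' S.carrier := fun S hS => Set.mem_iInter.1 hb ⟨S, hS⟩
  refine ⟨b, St.ext (Set.ext fun S => ⟨fun h => ?_, fun hS h => ?_⟩)⟩
  · by_contra hS
    exact h (hb S hS)
  -- For `S ∈ P` the section `S₀ \ S` stays outside `P`, so its image contains `b` and that of `S`
  -- does not.
  · have h' := hb (S₀ \ S) (by rw [hP.sdiff_mem_iff]; tauto)
    exact ((CopenSection.img_sdiff _ _ _).1 h').2 h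

theorem exists_isOpen_notMem {Y : Type u} [TopologicalSpace Y] [T1Space Y] {x y : Y} (h : x ≠ y) :
    ∃ U : Set Y, IsOpen U ∧ x ∈ U ∧ y ∉ U :=
  ⟨{y}ᶜ, isOpen_compl_singleton, h, fun h => h rfl⟩

theorem primeAt_injective : Function.Injective (primeAt (X := X)) := by
  intro b b' h
  by_contra hne
  have := X.isSkew.base.t2
  obtain ⟨U, hU, hb, hb'⟩ := exists_isOpen_notMem hne
  obtain ⟨e, rfl⟩ := X.isSkew.surjective b
  obtain ⟨S, hS, hSU⟩ := exists_copenSection (hU.preimage X.isSkew.etale.continuous) hb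
  have h1 : S ∉ (primeAt (X.p e)).ideal := notMem_primeAt.2 ⟨e, hS, rfl⟩
  rw [h, notMem_primeAt] at h1
  obtain ⟨e', he', rfl⟩ := h1
  exact hb' (hSU he')

theorem isHomeomorph_primeAt : IsHomeomorph (primeAt (X := X)) where
  continuous := by
    rw [St.isTopologicalBasis.continuous_iff]
    rintro _ ⟨S, rfl⟩
    have h : primeAt ⁻¹' St.basic S = X.p '' S.carrier := Set.ext fun b => notMem_primeAt
    rw [h]
    exact X.isSkew.etale.isOpenMap _ S.isOpen
  isOpenMap := by
    intro U hU
    rw [isOpen_iff_forall_mem_open]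
    rintro _ ⟨b, hb, rfl⟩
    obtain ⟨e, rfl⟩ := X.isSkew.surjective b
    obtain ⟨S, hS, hSU⟩ := exists_copenSection (hU.preimage X.isSkew.etale.continuous) hb
    refine ⟨St.basic S, fun P hPS => ?_, St.isOpen_basic S, notMem_primeAt.2 ⟨e, hS, rfl⟩⟩
    obtain ⟨b, rfl⟩ := exists_primeAt_eq P
    obtain ⟨e', he', rfl⟩ := notMem_primeAt.1 hPS
    exact ⟨_, hSU he', rfl⟩
  bijective := ⟨primeAt_injective, exists_primeAt_eq⟩

/-- The prime of `x` comes from a base point under `S`; the point of `S` above it gives `x`, as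
`M_S` has at most one point per fiber. -/
theorem exists_pointAt_eq {x : Sk (CopenSection X)} {S : CopenSection X} (hx : x ∈ Sk.basic S) :
    ∃ e ∈ S.carrier, pointAt e = x := by
  obtain ⟨b, hb⟩ := exists_primeAt_eq x.prime
  have hS := Sk.notMem_of_mem_basic hx
  rw [← hb, notMem_primeAt] at hS
  obtain ⟨e, he, rfl⟩ := hS
  exact ⟨e, he, Sk.injOn_basic S (pointAt_mem_basic.2 he) hx hb⟩

theorem isHomeomorph_pointAt : IsHomeomorph (pointAt (X := X)) where
  continuous := by
    rw [Sk.isTopologicalBasis.continuous_iff]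
    rintro _ ⟨S, rfl⟩
    have h : pointAt ⁻¹' Sk.basic S = S.carrier := Set.ext fun e => pointAt_mem_basic
    rw [h]
    exact S.isOpen
  isOpenMap := by
    intro U hU
    rw [isOpen_iff_forall_mem_open]
    rintro _ ⟨e, he, rfl⟩
    obtain ⟨S, hS, hSU⟩ := exists_copenSection hU he
    refine ⟨Sk.basic S, fun x hx => ?_, Sk.isOpen_basic S, pointAt_mem_basic.2 hS⟩
    obtain ⟨e', he', rfl⟩ := exists_pointAt_eq hx
    exact ⟨_, hSU he', rfl⟩
  bijective := by
    refine ⟨fun e e' h => ?_, fun x => ?_⟩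
    · by_contra hne
      have := X.isSkew.total.t2
      obtain ⟨U, hU, he, he'⟩ := exists_isOpen_notMem hne
      obtain ⟨S, hS, hSU⟩ := exists_copenSection hU he
      rw [← pointAt_mem_basic, h, pointAt_mem_basic] at hS
      exact he' (hSU hS)
    · obtain ⟨S, hS⟩ := x.exists_mem_basic
      obtain ⟨e, -, he⟩ := exists_pointAt_eq hS
      exact ⟨e, he⟩

end Points

/-- A skew Boolean space is isomorphic to the skew spectrum of its algebra of copen sections. -/
noncomputable def pointIso (X : SkewBooleanSpace.{u}) :
    X ≅ (spectrumFunctor spectrumWellDefined).obj (op (sectionFunctor.obj (op X))) :=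
  isoOfHomeomorph (Y := (spectrumFunctor spectrumWellDefined).obj (op (sectionFunctor.obj (op X))))
    (isHomeomorph_pointAt.homeomorph pointAt) (isHomeomorph_primeAt.homeomorph primeAt) fun _ => rfl

theorem preimage_primeAt {X Y : SkewBooleanSpace.{u}} (m : Hom X Y) {b : X.B} {b' : Y.B}
    (h : b' ∈ m.h b) : (primeAt b').ideal = m.pullHom.toFun ⁻¹' (primeAt b).ideal := by
  ext S
  refine not_congr (Iff.trans ?_ (m.img_pull S b).symm)
  exact ⟨fun hb => ⟨b', hb, h⟩, fun ⟨c, hc, hcb⟩ => Part.mem_unique h hcb ▸ hc⟩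

theorem pointAt_comp {X Y : SkewBooleanSpace.{u}} (m : Hom X Y) :
    (PFun.lift pointAt).comp m.g = m.pullHom.up.comp (PFun.lift pointAt) := by
  refine PFun.ext fun e y => ?_
  simp only [PFun.mem_comp_iff, mem_lift_iff, exists_eq_left]
  constructor
  · rintro ⟨e', he, rfl⟩
    obtain ⟨S, hS⟩ := exists_mem_copenSection e'
    refine (SkewHom.mem_up_iff _).2 ⟨preimage_primeAt m (m.isMorphism.comm _ _ he), S,
      pointAt_mem_basic.2 hS, pointAt_mem_basic.2 ?_⟩
    exact ⟨e', hS, he⟩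
  · intro hy
    -- A section representing `y` has inverse image through `e`, which forces `g` to be defined at
    -- `e`; thus the domains agree too.
    obtain ⟨h, S, hyS, he⟩ := (SkewHom.mem_up_iff _).1 hy
    rw [pointAt_mem_basic] at he
    obtain ⟨e', he', hee'⟩ := he
    refine ⟨e', hee', Sk.injOn_basic S hyS (pointAt_mem_basic.2 he') (St.ext (h.trans ?_))⟩
    exact (preimage_primeAt m (m.isMorphism.comm _ _ hee')).symm

theorem primeAt_comp {X Y : SkewBooleanSpace.{u}} (m : Hom X Y) :
    (PFun.lift primeAt).comp m.h = m.pullHom.down.comp (PFun.lift primeAt) := by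
  refine PFun.ext fun b Q => ?_
  simp only [PFun.mem_comp_iff, mem_lift_iff, exists_eq_left]
  rw [SkewHom.mem_down_iff]
  constructor
  · rintro ⟨b', hb, rfl⟩
    exact preimage_primeAt m hb
  · intro h
    obtain ⟨S, hS⟩ := Q.exists_notMem
    have hS' := hS
    rw [h] at hS'
    obtain ⟨b', -, hb⟩ := (m.img_pull S b).1 (notMem_primeAt.1 hS')
    exact ⟨b', hb, St.ext (h.trans (preimage_primeAt m hb).symm)⟩

theorem pointIso_naturality {X Y : SkewBooleanSpace.{u}} (m : X ⟶ Y) :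
    m ≫ (pointIso Y).hom =
      (pointIso X).hom ≫ (spectrumFunctor spectrumWellDefined).map (sectionFunctor.map m.op).op :=
  Hom.ext (pointAt_comp m) (primeAt_comp m)

end SkewBooleanSpace

/-! ### The elements of a skew algebra as copen sections -/

namespace RSkewAlg

open SkewBooleanSpace

/-- The isomorphism given by a bijective homomorphism. -/
noncomputable def isoOfBijective {A B : RSkewAlg.{u}} (f : SkewHom A.carrier B.carrier)
    (hf : Function.Bijective f.toFun) : A ≅ B :=
  have hr := Function.rightInverse_surjInv hf.2
  { hom := f
    inv :=
      { toFun := Function.surjInv hf.2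
        map_zero := hf.1 (by simp only [hr _, f.map_zero])
        map_inf := fun x y => hf.1 (by simp only [hr _, f.map_inf])
        map_sup := fun x y => hf.1 (by simp only [hr _, f.map_sup])
        map_sdiff := fun x y => hf.1 (by simp only [hr _, f.map_sdiff])
        map_inter := fun x y => hf.1 (by simp only [hr _, f.map_inter]) }
    hom_inv_id := SkewHom.ext (funext (Function.leftInverse_surjInv hf))
    inv_hom_id := SkewHom.ext (funext hr) }

/-- The skew spectrum of an algebra, as a skew Boolean space. -/
noncomputable abbrev spectrum (A : RSkewAlg.{u}) : SkewBooleanSpace.{u} :=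
  (spectrumFunctor spectrumWellDefined).obj (op A)

/-- The copen section `M_a` of the skew spectrum. -/
def sectionOf {A : RSkewAlg.{u}} (a : A.carrier) : CopenSection A.spectrum where
  carrier := Sk.basic a
  isCompact := Sk.isCompact_basic a
  isOpen := Sk.isOpen_basic a
  injOn := Sk.injOn_basic a

variable {A : RSkewAlg.{u}}

theorem image_sectionOf (a : A.carrier) (P : St A.carrier) :
    P ∈ (A.spectrum).p '' (sectionOf a).carrier ↔ a ∉ P.ideal :=
  Set.ext_iff.1 (Sk.image_basic a) P

/-- The homomorphism `a ↦ M_a`. -/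
def sectionHom (A : RSkewAlg.{u}) : SkewHom A.carrier (CopenSection A.spectrum) where
  toFun := sectionOf
  map_zero := CopenSection.ext (Set.ext fun x => Sk.mem_basic_zero x)
  map_inf a b := CopenSection.ext (Set.ext fun x => by
    refine (Sk.mem_basic_inf x a b).trans ?_
    rw [CopenSection.mem_inf]
    exact and_congr (image_sectionOf a x.prime).symm Iff.rfl)
  map_sup a b := CopenSection.ext (Set.ext fun x => by
    refine (Sk.mem_basic_sup x a b).trans ?_
    rw [CopenSection.mem_sup]
    exact or_congr Iff.rfl (and_congr Iff.rfl
      (not_not.symm.trans (not_congr (image_sectionOf a x.prime).symm))))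
  map_sdiff a b := CopenSection.ext (Set.ext fun x => by
    refine (Sk.mem_basic_sdiff x a b).trans ?_
    rw [CopenSection.mem_sdiff]
    exact and_congr Iff.rfl (not_not.symm.trans (not_congr (image_sectionOf b x.prime).symm)))
  map_inter a b := CopenSection.ext (Set.ext fun x => Sk.mem_basic_inter x a b)

/-- The set `M_a` determines, at each prime ideal, whether `a` lies in it and otherwise its class,
so `eq_of_primeRel` applies. -/
theorem sectionOf_injective : Function.Injective (sectionOf (A := A)) := by
  intro a b h
  refine SkewAlgebra.eq_of_primeRel fun P hP => ?_
  have h' : Sk.basic a = Sk.basic b := congrArg CopenSection.carrier h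
  by_cases ha : a ∈ P
  · refine Or.inl ⟨ha, ?_⟩
    by_contra hb
    have h2 := Sk.mkPoint_mem_basic ⟨P, hP⟩ b hb
    rw [← h'] at h2
    exact Sk.notMem_of_mem_basic h2 ha
  · have h2 := Sk.mkPoint_mem_basic ⟨P, hP⟩ a ha
    rw [h', Sk.mkPoint_mem_basic_iff] at h2
    exact h2.symm hP

/-- The sets `M_a` contained in a section `S` cover it and are directed under joins, so by
compactness one of them is all of `S`. -/
theorem sectionOf_surjective : Function.Surjective (sectionOf (A := A)) := by
  intro S
  have : Nonempty {a : A.carrier // Sk.basic a ⊆ S.carrier} :=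
    ⟨⟨0, fun x hx => ((Sk.mem_basic_zero x).1 hx).elim⟩⟩
  obtain ⟨⟨a, ha⟩, hSa⟩ := S.isCompact.elim_directed_cover
    (fun a : {a : A.carrier // Sk.basic a ⊆ S.carrier} => Sk.basic a.1)
    (fun a => Sk.isOpen_basic a.1) (fun x hx => by
      obtain ⟨_, ⟨a, rfl⟩, hxa, haS⟩ := Sk.isTopologicalBasis.exists_subset_of_mem_open hx S.isOpen
      exact Set.mem_iUnion.2 ⟨⟨a, haS⟩, hxa⟩) (by
      rintro ⟨a, ha⟩ ⟨b, hb⟩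
      refine ⟨⟨a ⊔ b, fun x hx => ?_⟩, fun x hx => ?_, fun x hx => ?_⟩
      · rcases (Sk.mem_basic_sup x a b).1 hx with h | h
        · exact ha h
        · exact hb h.1
      · exact (Sk.mem_basic_sup x a b).2 (Or.inl hx)
      · refine (Sk.mem_basic_sup x a b).2 ?_
        by_cases hax : a ∈ x.prime.ideal
        · exact Or.inr ⟨hx, hax⟩
        -- If `a` also has a point over the prime of `x`, that point is `x` itself, since both lie
        -- in `S`, which meets each fiber at most once.
        · have hy := Sk.mkPoint_mem_basic x.prime a hax
          have hxy := S.injOn (hb hx) (ha hy) rfl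
          rw [← hxy] at hy
          exact Or.inl hy)
  exact ⟨a, CopenSection.ext (ha.antisymm hSa)⟩

/-- An algebra is isomorphic to the algebra of copen sections of its skew spectrum. -/
noncomputable def sectionIso (A : RSkewAlg.{u}) :
    A ≅ sectionFunctor.obj (op ((spectrumFunctor spectrumWellDefined).obj (op A))) :=
  isoOfBijective (B := sectionFunctor.obj (op A.spectrum)) A.sectionHom
    ⟨sectionOf_injective, sectionOf_surjective⟩

theorem sectionIso_naturality {A B : RSkewAlg.{u}} (f : A ⟶ B) :
    f ≫ (sectionIso B).hom = (sectionIso A).hom ≫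
      sectionFunctor.map ((spectrumFunctor spectrumWellDefined).map f.op).op :=
  SkewHom.ext (funext fun a => CopenSection.ext (SkewHom.up_preimage_basic f a).symm)

end RSkewAlg

/-! ### The duality -/

/-- The duality between skew Boolean spaces and right-handed skew algebras. -/
noncomputable def skewDuality : SkewBooleanSpace.{u}ᵒᵖ ≌ RSkewAlg.{u} :=
  CategoryTheory.Equivalence.mk SkewBooleanSpace.sectionFunctor (spectrumFunctor spectrumWellDefined).rightOp
    (NatIso.ofComponents (fun X => (SkewBooleanSpace.pointIso X.unop).symm.op) fun {X Y} m => by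
      apply Quiver.Hom.unop_inj
      have h := SkewBooleanSpace.pointIso_naturality m.unop
      change (SkewBooleanSpace.pointIso Y.unop).inv ≫ m.unop =
        (spectrumFunctor spectrumWellDefined).map
          (SkewBooleanSpace.sectionFunctor.map m.unop.op).op ≫
            (SkewBooleanSpace.pointIso X.unop).inv
      rw [Iso.inv_comp_eq, ← Category.assoc, Iso.eq_comp_inv, h])
    (NatIso.ofComponents (fun A => (RSkewAlg.sectionIso A).symm) fun {A B} f => by
      have h := RSkewAlg.sectionIso_naturality f
      change SkewBooleanSpace.sectionFunctor.map
        ((spectrumFunctor spectrumWellDefined).map f.op).op ≫ (RSkewAlg.sectionIso B).inv =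
          (RSkewAlg.sectionIso A).inv ≫ f
      rw [Iso.eq_inv_comp, ← Category.assoc, Iso.comp_inv_eq, h])

/-! ### Total morphisms are pullback squares -/

theorem PContinuous.exists_eq_lift {X Y : Type u} [TopologicalSpace X] [TopologicalSpace Y]
    {f : X →. Y} (hf : PContinuous f) (hd : f.Dom = Set.univ) :
    ∃ g : C(X, Y), f = PFun.lift g := by
  have hdom : ∀ x, (f x).Dom := fun x => (hd ▸ Set.mem_univ x : x ∈ f.Dom)
  have h : f = PFun.lift fun x => (f x).get (hdom x) :=
    funext fun x => (Part.some_get (hdom x)).symm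
  refine ⟨⟨fun x => (f x).get (hdom x), ⟨fun s hs => ?_⟩⟩, h⟩
  rw [← PFun.coe_preimage, ← h]
  exact hf s hs

namespace SkewBooleanSpace

variable {X Y : SkewBooleanSpace.{u}}

/-- The map into the total space induced by a cone over a total morphism. -/
theorem exists_continuous_lift (m : Hom X Y) {g : C(X.E, Y.E)} {h : C(X.B, Y.B)}
    (hg : m.g = PFun.lift g) (hh : m.h = PFun.lift h) {W : Type u} [TopologicalSpace W]
    (a : C(W, Y.E)) (b : C(W, X.B)) (hab : ∀ w, Y.p (a w) = h (b w)) :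
    ∃ c : C(W, X.E), (∀ w, g (c w) = a w) ∧ ∀ w, X.p (c w) = b w := by
  have hcomm : ∀ e, Y.p (g e) = h (X.p e) := fun e => by
    have he := m.isMorphism.comm e (g e) (by rw [hg, mem_lift_iff])
    rwa [hh, mem_lift_iff] at he
  have hex : ∀ w, ∃! e, X.p e = b w ∧ a w ∈ m.g e := fun w =>
    m.isMorphism.bijOnFibers (b w) (h (b w)) (by rw [hh, mem_lift_iff]) (a w) (hab w)
  simp only [hg, mem_lift_iff] at hex
  choose c hc huniq using hex
  refine ⟨⟨c, continuous_iff_continuousAt.2 fun w => ?_⟩, fun w => (hc w).2.symm,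
    fun w => (hc w).1⟩
  rw [ContinuousAt, tendsto_nhds]
  intro U hU hw
  -- Near `w`, openness of `X.p` lifts `b v` to some `e` in `U ∩ g ⁻¹ V`. Injectivity of `Y.p` on
  -- `V` gives `g e = a v`, and uniqueness in the fiber gives `e = c v`.
  obtain ⟨V, hV, hwV, hinj⟩ := Y.isSkew.etale.isLocallyInjective (a w)
  have hU' : IsOpen (U ∩ g ⁻¹' V) := hU.inter (hV.preimage g.continuous)
  have hw' : c w ∈ U ∩ g ⁻¹' V := ⟨hw, by rw [Set.mem_preimage, ← (hc w).2]; exact hwV⟩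
  have h1 : b ⁻¹' (X.p '' (U ∩ g ⁻¹' V)) ∈ nhds w :=
    ((X.isSkew.etale.isOpenMap _ hU').preimage b.continuous).mem_nhds ⟨c w, hw', (hc w).1⟩
  filter_upwards [h1, (hV.preimage a.continuous).mem_nhds hwV] with v hv hva
  obtain ⟨e, he, hev⟩ := hv
  have hge : a v = g e := hinj hva he.2 (by rw [hab, hcomm, hev])
  rw [Set.mem_preimage, ← huniq v e ⟨hev, hge⟩]
  exact he.1

theorem isPullbackSquare_of_total (m : X ⟶ Y) (hm : total m) : IsPullbackSquare m := by
  obtain ⟨g, hg⟩ := (Hom.isMorphism m).top.continuous.exists_eq_lift hm.1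
  obtain ⟨h, hh⟩ := (Hom.isMorphism m).bot.continuous.exists_eq_lift hm.2
  have hcomm : ∀ e, Y.p (g e) = h (X.p e) := fun e => by
    have he := (Hom.isMorphism m).comm e (g e) (by rw [hg, mem_lift_iff])
    rwa [hh, mem_lift_iff] at he
  have hw : TopCat.ofHom g ≫ TopCat.ofHom Y.proj = TopCat.ofHom X.proj ≫ TopCat.ofHom h :=
    TopCat.hom_ext (ContinuousMap.ext hcomm)
  have key : ∀ s : Limits.PullbackCone (TopCat.ofHom Y.proj) (TopCat.ofHom h),
      ∃ c : C(s.pt, X.E), (∀ w, g (c w) = s.fst w) ∧ ∀ w, X.p (c w) = s.snd w := fun s =>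
    exists_continuous_lift m hg hh s.fst.hom s.snd.hom fun w =>
      ConcreteCategory.congr_hom s.condition w
  choose c hc hc' using key
  refine ⟨g, h, hg, hh, ⟨⟨hw⟩, ⟨Limits.PullbackCone.IsLimit.mk _ (fun s => TopCat.ofHom (c s))
    (fun s => TopCat.hom_ext (ContinuousMap.ext (hc s)))
    (fun s => TopCat.hom_ext (ContinuousMap.ext (hc' s))) fun s l hl hl' =>
      TopCat.hom_ext (ContinuousMap.ext fun w => ?_)⟩⟩⟩
  have h1 : g (l w) = s.fst w := ConcreteCategory.congr_hom hl w
  have h2 : X.p (l w) = s.snd w := ConcreteCategory.congr_hom hl' w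
  refine ((Hom.isMorphism m).bijOnFibers (X.p (l w)) (h (X.p (l w))) (by rw [hh, mem_lift_iff])
    (g (l w)) (hcomm _)).unique ⟨rfl, by rw [hg, mem_lift_iff]⟩ ⟨?_, ?_⟩
  · exact (hc' s w).trans h2.symm
  · rw [hg, mem_lift_iff]
    exact h1.trans (hc s w).symm

theorem total_iff_isPullbackSquare (m : X ⟶ Y) : total m ↔ IsPullbackSquare m := by
  refine ⟨isPullbackSquare_of_total m, ?_⟩
  rintro ⟨g, h, hg, hh, -⟩
  exact ⟨by rw [hg, PFun.dom_coe], by rw [hh, PFun.dom_coe]⟩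

/-! ### Total morphisms and `≤`-cofinal homomorphisms -/

/-- Compactness writes `S` as a member of the directed family of its subsections in `I`. These cover
`S` because `g` is defined at each point and each `S ∩ g ⁻¹ R` is `≤`-below `g ⁻¹ R`. -/
theorem leqCofinal_of_total (m : X ⟶ Y) (hm : total m) :
    leqCofinal (sectionFunctor.map m.op) := by
  refine Set.eq_univ_of_forall fun S I hI hSI => ?_
  change CopenSection X at S
  have hpull : ∀ R, Hom.pull m R ∈ I := fun R => hSI ⟨R, rfl⟩
  obtain ⟨⟨T, hTS, hT⟩, hST⟩ := S.isCompact.elim_directed_cover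
    (ι := {T : CopenSection X // T.carrier ⊆ S.carrier ∧ T ∈ I}) (fun T => T.1.carrier)
    (hι := ⟨⟨0, Set.empty_subset _, hI.zero_mem⟩⟩)
    (fun T => T.1.isOpen) (fun e he => by
      obtain ⟨e', he'⟩ := (PFun.mem_dom _ _).1 (hm.1 ▸ Set.mem_univ e : e ∈ (Hom.g m).Dom)
      obtain ⟨R, hR⟩ := exists_mem_copenSection e'
      refine Set.mem_iUnion.2 ⟨⟨S ∩ Hom.pull m R, Set.inter_subset_left, ?_⟩, he, e', hR, he'⟩
      exact hI.lower _ _ (SkewAlgebra.inter_le_right _ _) (hpull R)) (by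
      rintro ⟨T, hTS, hT⟩ ⟨R, hRS, hR⟩
      refine ⟨⟨T ⊔ R, ?_, hI.sup_mem _ hT _ hR⟩, fun e he => Or.inl he, fun e he => ?_⟩
      · rintro e (he | he)
        · exact hTS he
        · exact hRS he.1
      · by_cases h : X.p e ∈ X.p '' T.carrier
        · obtain ⟨e', he', h⟩ := h
          -- Inside the section `S` the skew join is the ordinary union, because `T` and `R` agree
          -- over common base points.
          exact Or.inl (S.injOn (hTS he') (hRS he) h ▸ he')
        · exact Or.inr ⟨he, h⟩)
  obtain rfl : T = S := CopenSection.ext (hTS.antisymm hST)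
  exact hT

/-- Sections inside the domain of `g` form a `≤`-ideal containing every `g ⁻¹ R`, so `g` is
everywhere defined; surjectivity of `p` then makes `h` everywhere defined. -/
theorem total_of_leqCofinal (m : X ⟶ Y) (hm : leqCofinal (sectionFunctor.map m.op)) :
    total m := by
  have hI : IsLeqIdeal {S : CopenSection X | S.carrier ⊆ (Hom.g m).Dom} :=
    { zero_mem := Set.empty_subset _
      sup_mem := by
        rintro S hS R hR e (he | he)
        · exact hS he
        · exact hR he.1
      lower := fun S R h hR => ((CopenSection.natLE_iff S R).1 h).trans hR }
  have hg : (Hom.g m).Dom = Set.univ := by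
    refine Set.eq_univ_of_forall fun e => ?_
    obtain ⟨S, hS⟩ := exists_mem_copenSection e
    have h : S ∈ leqIdeal (Set.range (Hom.pullHom m).toFun) :=
      Set.eq_univ_iff_forall.1 hm S
    refine h _ hI ?_ hS
    rintro _ ⟨R, rfl⟩
    exact Hom.pull_subset m R
  refine ⟨hg, Set.eq_univ_of_forall fun b => ?_⟩
  obtain ⟨e, rfl⟩ := X.isSkew.surjective b
  obtain ⟨e', he'⟩ := (PFun.mem_dom _ _).1 (hg ▸ Set.mem_univ e : e ∈ (Hom.g m).Dom)
  exact (PFun.mem_dom _ _).2 ⟨_, (Hom.isMorphism m).comm _ _ he'⟩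

theorem total_iff_leqCofinal (m : X ⟶ Y) :
    total m ↔ leqCofinal (sectionFunctor.map m.op) :=
  ⟨leqCofinal_of_total m, total_of_leqCofinal m⟩

end SkewBooleanSpace

theorem leqCofinal_of_surjective {A B : RSkewAlg.{u}} (f : A ⟶ B)
    (hf : Function.Surjective (SkewHom.toFun f)) : leqCofinal f :=
  Set.eq_univ_of_forall fun b _ _ hI => hI (hf b)

theorem leqCofinal_of_isIso {A B : RSkewAlg.{u}} (f : A ⟶ B) [IsIso f] : leqCofinal f :=
  leqCofinal_of_surjective f fun b =>
    ⟨SkewHom.toFun (inv f) b, congrFun (congrArg SkewHom.toFun (IsIso.inv_hom_id f)) b⟩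

theorem total_of_isIso {X Y : SkewBooleanSpace.{u}} (m : X ⟶ Y) [IsIso m] :
    SkewBooleanSpace.total m :=
  (SkewBooleanSpace.total_iff_leqCofinal m).2 (leqCofinal_of_isIso _)

/-- Naturality of `a ↦ M_a` expresses `f` and its double dual as each other conjugated by
isomorphisms, which are cofinal. -/
theorem leqCofinal_iff_total {A A' : RSkewAlg.{u}} (f : A ⟶ A') :
    leqCofinal f ↔
      SkewBooleanSpace.total ((spectrumFunctor spectrumWellDefined).map f.op) := by
  rw [SkewBooleanSpace.total_iff_leqCofinal]
  have h := RSkewAlg.sectionIso_naturality f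
  constructor
  · intro hf
    rw [← Iso.inv_comp_eq] at h
    rw [← h]
    exact leqCofinal_comp _ _ (leqCofinal_of_isIso _)
      (leqCofinal_comp _ _ hf (leqCofinal_of_isIso _))
  · intro hf
    rw [← Iso.eq_comp_inv] at h
    rw [h]
    exact leqCofinal_comp _ _ (leqCofinal_comp _ _ (leqCofinal_of_isIso _) hf)
      (leqCofinal_of_isIso _)

/-! ### The restricted duality -/

/-- Copen sections, as a functor on total morphisms. -/
def totalSectionFunctor :
    (WideSubcategory SkewBooleanSpace.total.{u})ᵒᵖ ⥤ WideSubcategory leqCofinal.{u} where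
  obj X := ⟨SkewBooleanSpace.sectionFunctor.obj (op X.unop.obj)⟩
  map m := ⟨SkewBooleanSpace.sectionFunctor.map m.unop.hom.op,
    SkewBooleanSpace.leqCofinal_of_total _ m.unop.property⟩
  map_id X := WideSubcategory.hom_ext _ (SkewBooleanSpace.sectionFunctor.map_id (op X.unop.obj))
  map_comp m n := WideSubcategory.hom_ext _
    (SkewBooleanSpace.sectionFunctor.map_comp m.unop.hom.op n.unop.hom.op)

/-- The skew spectrum, as a functor on `≤`-cofinal homomorphisms. -/
noncomputable def cofinalSpectrumFunctor :
    WideSubcategory leqCofinal.{u} ⥤ (WideSubcategory SkewBooleanSpace.total.{u})ᵒᵖ where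
  obj A := op ⟨(spectrumFunctor spectrumWellDefined).obj (op A.obj)⟩
  map f := Quiver.Hom.op ⟨(spectrumFunctor spectrumWellDefined).map f.hom.op,
    (leqCofinal_iff_total _).1 f.property⟩
  map_id A := Quiver.Hom.unop_inj (WideSubcategory.hom_ext _
    ((spectrumFunctor spectrumWellDefined).map_id (op A.obj)))
  map_comp f g := Quiver.Hom.unop_inj (WideSubcategory.hom_ext _
    ((spectrumFunctor spectrumWellDefined).map_comp g.hom.op f.hom.op))

/-- The duality between skew Boolean spaces with total morphisms and right-handed skew algebras
with `≤`-cofinal homomorphisms. -/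
noncomputable def totalSkewDuality :
    (WideSubcategory SkewBooleanSpace.total.{u})ᵒᵖ ≌ WideSubcategory leqCofinal.{u} :=
  CategoryTheory.Equivalence.mk totalSectionFunctor cofinalSpectrumFunctor
    (NatIso.ofComponents
      -- Isomorphisms and their inverses are total, so the unit of the full duality lives in the
      -- wide subcategory.
      (fun X => (WideSubcategory.isoMk (SkewBooleanSpace.pointIso X.unop.obj).symm
        (total_of_isIso _) (total_of_isIso _)).op) fun {X Y} m => by
      apply Quiver.Hom.unop_inj
      apply WideSubcategory.hom_ext
      have h := SkewBooleanSpace.pointIso_naturality m.unop.hom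
      change (SkewBooleanSpace.pointIso Y.unop.obj).inv ≫ m.unop.hom =
        (spectrumFunctor spectrumWellDefined).map
          (SkewBooleanSpace.sectionFunctor.map m.unop.hom.op).op ≫
            (SkewBooleanSpace.pointIso X.unop.obj).inv
      rw [Iso.inv_comp_eq, ← Category.assoc, Iso.eq_comp_inv, h])
    (NatIso.ofComponents
      (fun A => WideSubcategory.isoMk (RSkewAlg.sectionIso A.obj).symm
        (leqCofinal_of_isIso (RSkewAlg.sectionIso A.obj).inv)
        (leqCofinal_of_isIso (RSkewAlg.sectionIso A.obj).hom)) fun {A B} f => by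
      apply WideSubcategory.hom_ext
      have h := RSkewAlg.sectionIso_naturality f.hom
      change SkewBooleanSpace.sectionFunctor.map
        ((spectrumFunctor spectrumWellDefined).map f.hom.op).op ≫
          (RSkewAlg.sectionIso B.obj).inv = (RSkewAlg.sectionIso A.obj).inv ≫ f.hom
      rw [Iso.eq_inv_comp, ← Category.assoc, Iso.comp_inv_eq, h])

theorem mainTheorem7 :
    -- a morphism is total exactly when it is a pullback square
    (∀ {X Y : SkewBooleanSpace.{u}} (m : X ⟶ Y),
      SkewBooleanSpace.total m ↔ SkewBooleanSpace.IsPullbackSquare m) ∧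
    -- the skew spectrum is a functor, and
    ∃ w : SpectrumWellDefined.{u},
      -- copen sections and the skew spectrum form a duality,
      (∃ e : SkewBooleanSpace.{u}ᵒᵖ ≌ RSkewAlg.{u},
        e.functor = SkewBooleanSpace.sectionFunctor ∧ e.inverse = (spectrumFunctor w).rightOp) ∧
      -- under which total morphisms correspond to `≤`-cofinal homomorphisms, both ways,
      (∀ {X Y : SkewBooleanSpace.{u}} (m : X ⟶ Y),
        SkewBooleanSpace.total m ↔ leqCofinal (SkewBooleanSpace.sectionFunctor.map m.op)) ∧
      (∀ {A A' : RSkewAlg.{u}} (f : A ⟶ A'),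
        leqCofinal f ↔ SkewBooleanSpace.total ((spectrumFunctor w).map f.op)) ∧
      -- and the duality restricts to one between the two wide subcategories
      ∃ e : (WideSubcategory SkewBooleanSpace.total.{u})ᵒᵖ ≌ WideSubcategory leqCofinal.{u},
        e.functor ⋙ wideSubcategoryInclusion _ =
          (wideSubcategoryInclusion _).op ⋙ SkewBooleanSpace.sectionFunctor ∧
        e.inverse ⋙ (wideSubcategoryInclusion _).op =
          wideSubcategoryInclusion _ ⋙ (spectrumFunctor w).rightOp := by
  refine ⟨fun m => SkewBooleanSpace.total_iff_isPullbackSquare m, spectrumWellDefined,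
    ⟨skewDuality, rfl, rfl⟩, fun m => SkewBooleanSpace.total_iff_leqCofinal m,
    fun f => leqCofinal_iff_total f, totalSkewDuality, rfl, rfl⟩
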